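/- Let $d\ge 1$, let $\Omega\subset\mathbb R^d$ be a bounded open set with Lipschitz boundary, and let $\rho_0,\rho_1\in BV(\Omega)\cap L^\infty(\Omega)$ be nonnegative with $\operatorname{ess\,inf}_\Omega(\rho_0+\rho_1)>0$. Write $\rho=(\rho_0,\rho_1)$, and let $\mu$ be the measure on $\Omega\times\{0,1\}$ with $\mu(\,\cdot\times\{i\})=\rho_i\,dx$ for $i=0,1$; write $\mathbb E_{(x,y)\sim\mu}[f]=\int f\,d\mu$. Let $\mathfrak B(\Omega)$ be the family of Borel subsets of $\Omega$, let $\chi_A$ be the characteristic function of $A$, and let $B(x,r)$ be the open ball. A *Bayes classifier* is a minimizer of $B\mapsto\mathbb E_{(x,y)\sim\mu}[|\chi_B(x)-y|]$ over $\mathfrak B(\Omega)$. A *solution of adversarial training* with budget $\varepsilon>0$ is a minimizer of $$B\mapsto \mathbb E_{(x,y)\sim\mu}\Big[\sup_{\tilde x\in B(x,\varepsilon)\cap\Omega}|\chi_B(\tilde x)-y|\Big]$$ over $\mathfrak B(\Omega)$. For measurable $A\subset\Omega$ and $\varepsilon>0$ define the nonlocal perimeter $$\mathrm{Per}_\varepsilon(A;\rho)=\frac1\varepsilon\int_\Omega\Big(\operatorname*{ess\,sup}_{B(x,\varepsilon)\cap\Omega}\chi_A-\chi_A(x)\Big)\rho_0(x)\,dx+\frac1\varepsilon\int_\Omega\Big(\chi_A(x)-\operatorname*{ess\,inf}_{B(x,\varepsilon)\cap\Omega}\chi_A\Big)\rho_1(x)\,dx$$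 and the weighted local perimeter $$\mathrm{Per}(A;\rho)=\int_{\partial^*A\cap\Omega}\min\{\rho_0^{\nu}+\rho_1^{\nu},\ \rho_0^{-\nu}+\rho_1^{-\nu},\ \rho_0^{-\nu}+\rho_1^{\nu}\}\,d\mathcal H^{d-1}\quad\text{if }\chi_A\in BV(\Omega),\qquad \mathrm{Per}(A;\rho)=\infty\ \text{ otherwise.}$$ Here $\partial^*A$ is the reduced boundary, $\nu=D\chi_A/|D\chi_A|$ is the measure-theoretic inner normal of $A$, and $\rho_i^{\pm\nu}(x)=\lim_{r\downarrow0}$ of the average of $\rho_i$ over $\{y\in B(x,r):\langle y-x,\pm\nu\rangle>0\}$ are the one-sided traces. Let $\varepsilon_k>0$ with $\varepsilon_k\to0$, and assume the weak source condition (wSC) along this sequence: there are a Bayes classifier $A^\dagger$ with $\mathrm{Per}(A^\dagger;\rho)<\infty$ and measurable sets $A_k^\dagger\subset\Omega$ that form a recovery sequence for $A^\dagger$, i.e. $\chi_{A_k^\dagger}\to\chi_{A^\dagger}$ in $L^1(\Omega)$ and $\limsup_{k\to\infty}\mathrm{Per}_{\varepsilon_k}(A_k^\dagger;\rho)\le\mathrm{Per}(A^\dagger;\rho)$,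 such that in addition $\mathcal L^d(A^\dagger\triangle A_k^\dagger)=o(\varepsilon_k)$. Then every sequence $(A_k)$, where $A_k$ is a solution of adversarial training with budget $\varepsilon_k$, is precompact in $L^1(\Omega)$: every subsequence of $(\chi_{A_k})$ has a further subsequence that converges in $L^1(\Omega)$ to $\chi_{A_0}$ for some Borel set $A_0\subset\Omega$. -/

import Mathlib

open MeasureTheory Set Filter Topology
open scoped ENNReal NNReal

noncomputable section

namespace AdvTraining

/-- Euclidean space `ℝ^d`. -/
abbrev E (d : ℕ) : Type := EuclideanSpace ℝ (Fin d)

variable {d : ℕ}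

/-- The characteristic function `χ_A` (real valued). -/
def chi (A : Set (E d)) : E d → ℝ := A.indicator (fun _ => 1)

/-! ### Domains and functions of bounded variation -/

/-- `Ω` is a bounded open set with Lipschitz boundary: near each boundary point, `Ω` is, in suitable
orthonormal coordinates, the strict epigraph of a Lipschitz function. Here `e` is the vertical
direction, `inner ℝ e y` the height of `y`, and `y - inner ℝ e y • e` its horizontal part. -/
structure IsBoundedLipschitzDomain (Ω : Set (E d)) : Prop where
  isOpen : IsOpen Ω
  isBounded : Bornology.IsBounded Ω
  lipschitz_boundary : ∀ x ∈ frontier Ω, ∃ (r : ℝ) (e : E d) (K : ℝ≥0) (g : E d → ℝ),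
    0 < r ∧ ‖e‖ = 1 ∧ LipschitzWith K g ∧
      ∀ y ∈ Metric.ball x r, (y ∈ Ω ↔ g (y - inner ℝ e y • e) < inner ℝ e y)

/-- The divergence of a vector field. -/
def divergence (φ : E d → E d) (x : E d) : ℝ :=
  ∑ i : Fin d, (fderiv ℝ φ x (EuclideanSpace.single i 1)) i

/-- `(m, σ)` is the polar decomposition of the distributional derivative `Du` of `u` on `Ω`:
`Du = σ m`, where `m = |Du|` is a finite Borel measure carried by `Ω` and `|σ| = 1` `m`-a.e.
(The pair is unique, `σ` up to `m`-null sets.) -/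
structure IsPolarDerivative (Ω : Set (E d)) (u : E d → ℝ) (m : Measure (E d)) (σ : E d → E d) :
    Prop where
  isFinite : IsFiniteMeasure m
  carried : m Ωᶜ = 0
  measurable : Measurable σ
  norm_one : ∀ᵐ x ∂m, ‖σ x‖ = 1
  integral_div : ∀ φ : E d → E d, ContDiff ℝ 1 φ → HasCompactSupport φ → tsupport φ ⊆ Ω →
    ∫ x in Ω, u x * divergence φ x = - ∫ x, inner ℝ (φ x) (σ x) ∂m

/-- `u ∈ BV(Ω)`: `u ∈ L¹(Ω)` and its distributional derivative is a finite vector measure. -/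
def MemBV (Ω : Set (E d)) (u : E d → ℝ) : Prop :=
  IntegrableOn u Ω ∧ ∃ m σ, IsPolarDerivative Ω u m σ

open Classical in
/-- The total variation measure `|Du|` of `u ∈ BV(Ω)` (zero if `u ∉ BV(Ω)`). -/
def variationMeasure (Ω : Set (E d)) (u : E d → ℝ) : Measure (E d) :=
  if h : MemBV Ω u then h.2.choose else 0

open Classical in
/-- The density `Du / |Du|` of `u ∈ BV(Ω)` (zero if `u ∉ BV(Ω)`). -/
def polarField (Ω : Set (E d)) (u : E d → ℝ) : E d → E d :=
  if h : MemBV Ω u then h.2.choose_spec.choose else 0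

/-! ### Reduced boundary, traces and the weighted perimeter -/

/-- The quotient `Dχ_A(B(x,r)) / |Dχ_A|(B(x,r))`. -/
def normalQuotient (Ω A : Set (E d)) (x : E d) (r : ℝ) : E d :=
  ((variationMeasure Ω (chi A)).real (Metric.ball x r))⁻¹ •
    ∫ y in Metric.ball x r, polarField Ω (chi A) y ∂(variationMeasure Ω (chi A))

/-- The measure-theoretic inner normal
`ν_A(x) = lim_{r ↓ 0} Dχ_A(B(x,r)) / |Dχ_A|(B(x,r))`, meaningful on the reduced boundary. -/
def innerNormal (Ω A : Set (E d)) (x : E d) : E d :=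
  limUnder (𝓝[>] (0 : ℝ)) (normalQuotient Ω A x)

/-- The reduced boundary `∂*A ∩ Ω`: the points of `Ω` in the support of `|Dχ_A|` at which the limit
defining `ν_A` exists and has length one. -/
def reducedBoundary (Ω A : Set (E d)) : Set (E d) :=
  {x | x ∈ Ω ∧ (∀ r > 0, 0 < variationMeasure Ω (chi A) (Metric.ball x r)) ∧
    Tendsto (normalQuotient Ω A x) (𝓝[>] 0) (𝓝 (innerNormal Ω A x)) ∧ ‖innerNormal Ω A x‖ = 1}

/-- The one-sided trace `u^ν(x)`: the limit as `r ↓ 0` of the averages of `u` over the half balls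
`{y ∈ B(x,r) : ⟨y - x, ν⟩ > 0}`. -/
def oneSidedTrace (u : E d → ℝ) (ν x : E d) : ℝ :=
  limUnder (𝓝[>] (0 : ℝ)) fun r =>
    ⨍ y in Metric.ball x r ∩ {y | 0 < inner ℝ (y - x) ν}, u y

/-- The anisotropic density
`β(ν;ρ) = min {ρ₀^ν + ρ₁^ν, ρ₀^{-ν} + ρ₁^{-ν}, ρ₀^{-ν} + ρ₁^ν}`. -/
def beta (ρ₀ ρ₁ : E d → ℝ) (ν x : E d) : ℝ :=
  min (oneSidedTrace ρ₀ ν x + oneSidedTrace ρ₁ ν x)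
    (min (oneSidedTrace ρ₀ (-ν) x + oneSidedTrace ρ₁ (-ν) x)
      (oneSidedTrace ρ₀ (-ν) x + oneSidedTrace ρ₁ ν x))

open Classical in
/-- The weighted perimeter `Per(A;ρ) = ∫_{∂*A ∩ Ω} β(ν_A;ρ) dH^{d-1}` if `χ_A ∈ BV(Ω)`, and `∞`
otherwise. The Hausdorff measure is normalized so that `H^k` is Lebesgue measure on `ℝ^k`. -/
def weightedPerimeter (Ω : Set (E d)) (ρ₀ ρ₁ : E d → ℝ) (A : Set (E d)) : ℝ≥0∞ :=
  if MemBV Ω (chi A) then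
    ∫⁻ x in reducedBoundary Ω A, ENNReal.ofReal (beta ρ₀ ρ₁ (innerNormal Ω A x) x)
      ∂(Measure.euclideanHausdorffMeasure (d - 1))
  else ∞

/-- The nonlocal perimeter
`Per_ε(A;ρ) = ε⁻¹ ∫_Ω (ess sup_{B(x,ε)∩Ω} χ_A - χ_A(x)) ρ₀(x) dx
  + ε⁻¹ ∫_Ω (χ_A(x) - ess inf_{B(x,ε)∩Ω} χ_A) ρ₁(x) dx`.
For `ε > 0` both differences are nonnegative for a.e. `x ∈ Ω`. -/
def nonlocalPerimeter (Ω : Set (E d)) (ρ₀ ρ₁ : E d → ℝ) (ε : ℝ) (A : Set (E d)) : ℝ≥0∞ :=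
  ENNReal.ofReal ε⁻¹ * (∫⁻ x in Ω, ENNReal.ofReal
    ((essSup (chi A) (volume.restrict (Metric.ball x ε ∩ Ω)) - chi A x) * ρ₀ x)) +
  ENNReal.ofReal ε⁻¹ * (∫⁻ x in Ω, ENNReal.ofReal
    ((chi A x - essInf (chi A) (volume.restrict (Metric.ball x ε ∩ Ω))) * ρ₁ x))

/-! ### Adversarial training -/

/-- The measure on `Ω` with Lebesgue density `ρ`. -/
def densityMeasure (Ω : Set (E d)) (ρ : E d → ℝ) : Measure (E d) :=
  (volume.restrict Ω).withDensity fun x => ENNReal.ofReal (ρ x)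

/-- The data distribution `μ` on points with labels in `{0, 1}`, with `μ(· × {0}) = ρ₀` and
`μ(· × {1}) = ρ₁`. -/
def dataMeasure (Ω : Set (E d)) (ρ₀ ρ₁ : E d → ℝ) : Measure (E d × Fin 2) :=
  (densityMeasure Ω ρ₀).map (fun x => (x, 0)) + (densityMeasure Ω ρ₁).map (fun x => (x, 1))

/-- The loss `|χ_A(x) - y|`. -/
def loss (A : Set (E d)) (x : E d) (y : Fin 2) : ℝ≥0∞ :=
  ENNReal.ofReal |chi A x - ((y : ℕ) : ℝ)|

/-- The standard risk `E_{(x,y)∼μ} |χ_A(x) - y|`. -/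
def standardRisk (Ω : Set (E d)) (ρ₀ ρ₁ : E d → ℝ) (A : Set (E d)) : ℝ≥0∞ :=
  ∫⁻ z, loss A z.1 z.2 ∂(dataMeasure Ω ρ₀ ρ₁)

/-- The adversarial risk `E_{(x,y)∼μ} [sup_{x' ∈ B(x,ε) ∩ Ω} |χ_A(x') - y|]`. -/
def adversarialRisk (Ω : Set (E d)) (ρ₀ ρ₁ : E d → ℝ) (ε : ℝ) (A : Set (E d)) : ℝ≥0∞ :=
  ∫⁻ z, ⨆ x' ∈ Metric.ball z.1 ε ∩ Ω, loss A x' z.2 ∂(dataMeasure Ω ρ₀ ρ₁)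

/-- `A` minimizes `F` among the Borel subsets of `Ω`. -/
def IsBorelMinimizer (Ω : Set (E d)) (F : Set (E d) → ℝ≥0∞) (A : Set (E d)) : Prop :=
  (MeasurableSet A ∧ A ⊆ Ω) ∧ ∀ B, MeasurableSet B → B ⊆ Ω → F A ≤ F B

/-- A Bayes classifier: a minimizer of the standard risk. -/
def IsBayesClassifier (Ω : Set (E d)) (ρ₀ ρ₁ : E d → ℝ) (A : Set (E d)) : Prop :=
  IsBorelMinimizer Ω (standardRisk Ω ρ₀ ρ₁) A

/-- A solution of adversarial training with budget `ε`. -/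
def IsAdversarialSolution (Ω : Set (E d)) (ρ₀ ρ₁ : E d → ℝ) (ε : ℝ) (A : Set (E d)) : Prop :=
  IsBorelMinimizer Ω (adversarialRisk Ω ρ₀ ρ₁ ε) A

/-! ### Convergence and the source condition -/

/-- `χ_{A k} → χ_A` in `L¹(Ω)`. -/
def TendstoL1 (Ω : Set (E d)) (A : ℕ → Set (E d)) (A₀ : Set (E d)) : Prop :=
  Tendsto (fun k => eLpNorm (chi (A k) - chi A₀) 1 (volume.restrict Ω)) atTop (𝓝 0)

/-- `(A k)` is a recovery sequence for `A₀` along `(ε k)`, for the Gamma-convergence of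
`Per_ε(·;ρ)` to `Per(·;ρ)` in `L¹(Ω)`. -/
structure IsRecoverySequence (Ω : Set (E d)) (ρ₀ ρ₁ : E d → ℝ) (ε : ℕ → ℝ) (A : ℕ → Set (E d))
    (A₀ : Set (E d)) : Prop where
  measurable : ∀ k, MeasurableSet (A k) ∧ A k ⊆ Ω
  tendsto : TendstoL1 Ω A A₀
  limsup_le : limsup (fun k => nonlocalPerimeter Ω ρ₀ ρ₁ (ε k) (A k)) atTop ≤
    weightedPerimeter Ω ρ₀ ρ₁ A₀

/-- The weak source condition along `(ε k)`: some Bayes classifier `A†` with `Per(A†;ρ) < ∞` has a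
recovery sequence `(A k)` with `L^d(A† ∆ A k) = o(ε k)`. -/
def WeakSourceCondition (Ω : Set (E d)) (ρ₀ ρ₁ : E d → ℝ) (ε : ℕ → ℝ) : Prop :=
  ∃ A₀ : Set (E d), IsBayesClassifier Ω ρ₀ ρ₁ A₀ ∧ weightedPerimeter Ω ρ₀ ρ₁ A₀ < ∞ ∧
    ∃ A : ℕ → Set (E d), IsRecoverySequence Ω ρ₀ ρ₁ ε A A₀ ∧
      (fun k => volume.real (symmDiff A₀ (A k))) =o[atTop] ε

/-- `(χ_{A k})` is precompact in `L¹(Ω)`: each subsequence has a further subsequence converging in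
`L¹(Ω)` (and then the limit is again a characteristic function). -/
def IsPrecompactL1 (Ω : Set (E d)) (A : ℕ → Set (E d)) : Prop :=
  ∀ ψ : ℕ → ℕ, StrictMono ψ → ∃ φ : ℕ → ℕ, StrictMono φ ∧
    ∃ A₀ : Set (E d), MeasurableSet A₀ ∧ A₀ ⊆ Ω ∧ TendstoL1 Ω (fun k => A (ψ (φ k))) A₀

end AdvTraining

end

open AdvTraining

/-!
The adversarial risk of a solution equals its standard risk plus `ε` times its nonlocal perimeter,
since replacing a set by its essential closure turns essential suprema into suprema. Comparing a
solution with `A_k†`, whose standard risk exceeds the Bayes risk by `O(ε_k)`, bounds the nonlocal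
perimeters of the solutions.

A translation by `|h| < ε` moves a point across the boundary of `A` only inside the strips counted
by `Per_ε(A; ρ)`. One strip is weighted by `ρ₀` and the other by `ρ₁`; both densities can be
evaluated at the same point at the cost of `|h| |Dρ_i|(Ω)`, and `ρ₀ + ρ₁ ≥ c` makes the estimate
unweighted. Cutting a longer translation into steps shorter than `ε` gives
`c |K ∩ (A ∆ (A - h))| ≤ C (|h| + ε)` on compact sets `K ⊆ Ω`. The `ε_k` tend to zero, so this
asymptotic equicontinuity suffices for a Riesz–Kolmogorov argument: the masses of the sets in small
balls converge along a subsequence, and equicontinuity makes that subsequence Cauchy in `L¹`.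
-/

namespace AdvTraining

section Translation

/-- The points `x` for which the whole segment from `x` to `x + h` lies in `Ω`. On such points the
variation of a function on `Ω` controls its change under translation by `h`. -/
def segmentDomain {F : Type*} [AddCommGroup F] [Module ℝ F] (Ω : Set F) (h : F) : Set F :=
  {x | ∀ t ∈ Icc (0 : ℝ) 1, x + t • h ∈ Ω}

lemma add_nsmul_mem_segmentDomain {F : Type*} [AddCommGroup F] [Module ℝ F] {Ω : Set F} {x h : F}
    {n j : ℕ} (hx : x ∈ segmentDomain Ω (n • h)) (hj : j < n) : x + j • h ∈ segmentDomain Ω h := by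
  intro t ht
  have hn : (0 : ℝ) < n := by exact_mod_cast j.zero_le.trans_lt hj
  have hjt : (j : ℝ) + t ≤ n := by
    have : (j : ℝ) + 1 ≤ n := by exact_mod_cast hj
    linarith [ht.2]
  convert hx ((j + t) / n) ⟨by have := ht.1; positivity, (div_le_one hn).2 hjt⟩ using 1
  rw [← Nat.cast_smul_eq_nsmul ℝ n, smul_smul, div_mul_cancel₀ _ hn.ne', add_smul,
    Nat.cast_smul_eq_nsmul, add_assoc]

variable {F : Type*} [NormedAddCommGroup F] [NormedSpace ℝ F]

lemma isOpen_segmentDomain {Ω : Set F} (hΩ : IsOpen Ω) (h : F) : IsOpen (segmentDomain Ω h) := by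
  refine isOpen_iff_mem_nhds.2 fun x hx => ?_
  refine isCompact_Icc.eventually_forall_of_forall_eventually fun t ht => ?_
  have hcont : Continuous fun p : F × ℝ => p.1 + p.2 • h := by fun_prop
  exact hcont.continuousAt.eventually (hΩ.mem_nhds (hx t ht))

lemma exists_forall_subset_segmentDomain {Ω K : Set F} (hΩ : IsOpen Ω) (hK : IsCompact K)
    (hKΩ : K ⊆ Ω) : ∃ r > 0, ∀ h : F, ‖h‖ < r → K ⊆ segmentDomain Ω h := by
  obtain ⟨r, hr, hthick⟩ := hK.exists_thickening_subset_open hΩ hKΩ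
  refine ⟨r, hr, fun h hh x hx t ht => hthick (Metric.mem_thickening_iff.2 ⟨x, hx, ?_⟩)⟩
  rw [dist_self_add_left, norm_smul, Real.norm_of_nonneg ht.1]
  exact (mul_le_of_le_one_left (norm_nonneg h) ht.2).trans_lt hh

lemma hasDerivAt_integral_mul_comp_sub_smul [MeasurableSpace F] [OpensMeasurableSpace F]
    {μ : Measure F} {u ψ : F → ℝ} (hu : Integrable u μ) (hψ : ContDiff ℝ 1 ψ)
    (hc : HasCompactSupport ψ) (h : F) (t : ℝ) :
    HasDerivAt (fun s => ∫ y, u y * ψ (y - s • h) ∂μ)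
      (∫ y, u y * -(fderiv ℝ ψ (y - t • h) h) ∂μ) t := by
  have hdiff : Differentiable ℝ ψ := hψ.differentiable one_ne_zero
  have hψ' : Continuous (fderiv ℝ ψ) := hψ.continuous_fderiv one_ne_zero
  obtain ⟨B, hB⟩ := hc.exists_bound_of_continuous hψ.continuous
  obtain ⟨C, hC⟩ := (hc.fderiv ℝ).exists_bound_of_continuous hψ'
  have hmeas : ∀ s : ℝ, AEStronglyMeasurable (fun y => ψ (y - s • h)) μ := fun s =>
    (hψ.continuous.comp (by fun_prop)).aestronglyMeasurable
  have hmeas' : AEStronglyMeasurable (fun y => -(fderiv ℝ ψ (y - t • h) h)) μ :=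
    ((hψ'.comp (by fun_prop)).clm_apply continuous_const).neg.aestronglyMeasurable
  have hline : ∀ (y : F) (s : ℝ),
      HasDerivAt (fun s : ℝ => ψ (y - s • h)) (-(fderiv ℝ ψ (y - s • h) h)) s := by
    intro y s
    have hsub : HasDerivAt (fun s : ℝ => y - s • h) (-h) s := by
      simpa using ((hasDerivAt_id s).smul_const h).const_sub y
    simpa [Function.comp_def] using (hdiff (y - s • h)).hasFDerivAt.comp_hasDerivAt s hsub
  refine (hasDerivAt_integral_of_dominated_loc_of_deriv_le (s := univ)
    (bound := fun y => |u y| * (C * ‖h‖)) univ_mem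
    (Eventually.of_forall fun s => hu.aestronglyMeasurable.mul (hmeas s))
    (hu.mul_bdd (hmeas t) (ae_of_all _ fun y => hB _))
    (hu.aestronglyMeasurable.mul hmeas') (ae_of_all _ fun y s _ => ?_) (hu.abs.mul_const _)
    (ae_of_all _ fun y s _ => (hline y s).const_mul (u y))).2
  rw [norm_mul, norm_neg, Real.norm_eq_abs]
  gcongr
  exact (ContinuousLinearMap.le_opNorm _ _).trans (by gcongr; exact hC _)

lemma exists_contDiff_hasCompactSupport_eq_one_on [FiniteDimensional ℝ F] {S U : Set F}
    (hS : IsCompact S) (hU : IsOpen U) (hSU : S ⊆ U) :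
    ∃ ψ : F → ℝ, ContDiff ℝ 1 ψ ∧ HasCompactSupport ψ ∧ tsupport ψ ⊆ U ∧ EqOn ψ 1 S ∧
      ∀ x, ψ x ∈ Icc 0 1 := by
  obtain ⟨L, hL, hSL, hLU⟩ := exists_compact_between hS hU hSU
  obtain ⟨ψ, hψ0, hψ1, hψ⟩ := exists_contMDiffMap_zero_one_of_isClosed (n := 1)
    (modelWithCornersSelf ℝ F) isOpen_interior.isClosed_compl hS.isClosed
    (disjoint_compl_left_iff_subset.2 hSL)
  have hsupp : Function.support ψ ⊆ L := fun x hx =>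
    interior_subset (not_not.1 fun hxL => hx (hψ0 hxL))
  exact ⟨ψ, ψ.contMDiff.contDiff, HasCompactSupport.of_support_subset_isCompact hL hsupp,
    (closure_minimal hsupp hL.isClosed).trans hLU, hψ1, hψ⟩

end Translation

section IndicatorComparison

variable {X : Type*} [MeasurableSpace X] {μ : Measure X} [IsFiniteMeasure μ] {f : X → ℝ} {S : Set X}

lemma measureReal_le_integral_of_indicator_le (hS : MeasurableSet S) (hf : Integrable f μ)
    (hSf : S.indicator 1 ≤ f) : μ.real S ≤ ∫ x, f x ∂μ := by
  rw [← integral_indicator_one hS]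
  exact integral_mono ((integrable_const 1).indicator hS) hf hSf

lemma integral_le_measureReal_of_le_indicator (hS : MeasurableSet S) (hf : Integrable f μ)
    (hfS : f ≤ S.indicator 1) : ∫ x, f x ∂μ ≤ μ.real S := by
  rw [← integral_indicator_one hS]
  exact integral_mono hf ((integrable_const 1).indicator hS) hfS

end IndicatorComparison

section BoundedVariation

variable {d : ℕ} {Ω S : Set (E d)} {u ψ : E d → ℝ} {m : Measure (E d)} {σ : E d → E d} {h : E d}

lemma divergence_smul_const {x : E d} (hψ : DifferentiableAt ℝ ψ x) (h : E d) :
    divergence (fun y => ψ y • h) x = fderiv ℝ ψ x h := by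
  unfold divergence
  rw [fderiv_smul_const hψ]
  conv_rhs => rw [← (EuclideanSpace.basisFun (Fin d) ℝ).sum_repr h, map_sum]
  exact Finset.sum_congr rfl fun i _ => by simp [mul_comm]

lemma IsPolarDerivative.integral_mul_fderiv (hm : IsPolarDerivative Ω u m σ)
    (hψ : ContDiff ℝ 1 ψ) (hc : HasCompactSupport ψ) (hs : tsupport ψ ⊆ Ω) (h : E d) :
    ∫ x in Ω, u x * fderiv ℝ ψ x h = -∫ x, inner ℝ (ψ x • h) (σ x) ∂m := by
  rw [← hm.integral_div (fun x => ψ x • h) (hψ.smul contDiff_const) hc.smul_right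
    ((tsupport_smul_subset_left _ _).trans hs)]
  simp only [divergence_smul_const (hψ.differentiable one_ne_zero _)]

lemma IsPolarDerivative.abs_integral_mul_fderiv_le (hm : IsPolarDerivative Ω u m σ)
    (hψ : ContDiff ℝ 1 ψ) (hc : HasCompactSupport ψ) (hs : tsupport ψ ⊆ Ω)
    (hb : ∀ x, |ψ x| ≤ 1) (h : E d) :
    |∫ x in Ω, u x * fderiv ℝ ψ x h| ≤ ‖h‖ * m.real univ := by
  have := hm.isFinite
  rw [hm.integral_mul_fderiv hψ hc hs, abs_neg, ← Real.norm_eq_abs]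
  refine norm_integral_le_of_norm_le_const ?_
  filter_upwards [hm.norm_one] with x hx
  calc ‖inner ℝ (ψ x • h) (σ x)‖ ≤ ‖ψ x • h‖ * ‖σ x‖ := norm_inner_le_norm _ _
    _ = |ψ x| * ‖h‖ := by rw [hx, mul_one, norm_smul, Real.norm_eq_abs]
    _ ≤ ‖h‖ := mul_le_of_le_one_left (norm_nonneg _) (hb x)

lemma IsPolarDerivative.abs_integral_mul_comp_sub_sub_le (hm : IsPolarDerivative Ω u m σ)
    (hu : IntegrableOn u Ω) (hψ : ContDiff ℝ 1 ψ) (hc : HasCompactSupport ψ)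
    (hb : ∀ x, |ψ x| ≤ 1) (hs : tsupport ψ ⊆ segmentDomain Ω h) :
    |(∫ y in Ω, u y * ψ (y - h)) - ∫ y in Ω, u y * ψ y| ≤ ‖h‖ * m.real univ := by
  have hbound : ∀ t ∈ Icc (0 : ℝ) 1,
      ‖∫ y in Ω, u y * -(fderiv ℝ ψ (y - t • h) h)‖ ≤ ‖h‖ * m.real univ := by
    intro t ht
    have hsupp : tsupport (fun y => ψ (y - t • h)) ⊆ Ω := by
      rw [show tsupport (fun y => ψ (y - t • h)) = (fun y => y - t • h) ⁻¹' tsupport ψ from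
        tsupport_comp_eq_preimage ψ (Homeomorph.subRight (t • h))]
      intro y hy
      simpa using hs hy t ht
    have := hm.abs_integral_mul_fderiv_le (hψ.comp (contDiff_id.sub contDiff_const))
      (hc.comp_homeomorph (Homeomorph.subRight (t • h))) hsupp (fun _ => hb _) h
    simpa only [mul_neg, integral_neg, norm_neg, Real.norm_eq_abs, Function.comp_def, id_eq,
      fderiv_comp_sub] using! this
  simpa using norm_image_sub_le_of_norm_deriv_le_segment_01'
    (fun t _ => (hasDerivAt_integral_mul_comp_sub_smul hu hψ hc h t).hasDerivWithinAt)
    (fun t ht => hbound t (Ico_subset_Icc_self ht))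

lemma isFiniteMeasure_densityMeasure (hu : IntegrableOn u Ω) :
    IsFiniteMeasure (densityMeasure Ω u) :=
  isFiniteMeasure_withDensity_ofReal hu.2

lemma integral_densityMeasure (hu : IntegrableOn u Ω) (hu0 : ∀ᵐ x ∂volume.restrict Ω, 0 ≤ u x)
    (f : E d → ℝ) : ∫ x, f x ∂densityMeasure Ω u = ∫ x in Ω, u x * f x := by
  rw [densityMeasure, integral_withDensity_eq_integral_toReal_smul₀
    hu.aestronglyMeasurable.aemeasurable.ennreal_ofReal (by simp)]
  refine integral_congr_ae ?_
  filter_upwards [hu0] with x hx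
  rw [ENNReal.toReal_ofReal hx, smul_eq_mul]

lemma IsPolarDerivative.densityMeasure_le_add_of_isCompact (hm : IsPolarDerivative Ω u m σ)
    (hΩ : IsOpen Ω) (hu : IntegrableOn u Ω) (hu0 : ∀ᵐ x ∂volume.restrict Ω, 0 ≤ u x)
    (hS : IsCompact S) (hSh : S ⊆ segmentDomain Ω h) :
    densityMeasure Ω u S ≤ densityMeasure Ω u ((· - h) ⁻¹' S) + ‖h‖ₑ * m univ := by
  have := isFiniteMeasure_densityMeasure hu
  have := hm.isFinite
  refine ENNReal.le_of_forall_pos_le_add fun η hη _ => ?_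
  obtain ⟨V, hSV, hV, hVη⟩ := ((· - h) ⁻¹' S).exists_isOpen_le_add (densityMeasure Ω u)
    (ENNReal.coe_ne_zero.2 hη.ne')
  obtain ⟨ψ, hψ, hc, hsupp, hψS, hψI⟩ := exists_contDiff_hasCompactSupport_eq_one_on hS
    ((isOpen_segmentDomain hΩ h).inter (hV.preimage (continuous_add_const h)))
    (subset_inter hSh fun x hx => hSV (by simpa using hx))
  have htrans := (abs_le.1 (hm.abs_integral_mul_comp_sub_sub_le hu hψ hc
    (fun x => abs_le.2 ⟨by linarith [(hψI x).1], (hψI x).2⟩)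
    (hsupp.trans inter_subset_left))).1
  rw [← integral_densityMeasure hu hu0, ← integral_densityMeasure hu hu0 ψ] at htrans
  have hlower : (densityMeasure Ω u).real S ≤ ∫ y, ψ y ∂densityMeasure Ω u :=
    measureReal_le_integral_of_indicator_le hS.measurableSet
      (hψ.continuous.integrable_of_hasCompactSupport hc)
      (indicator_le' (fun y hy => (hψS hy).ge) (fun y _ => (hψI y).1))
  have hupper : ∫ y, ψ (y - h) ∂densityMeasure Ω u ≤ (densityMeasure Ω u).real V := by
    refine integral_le_measureReal_of_le_indicator hV.measurableSet
      ((hψ.continuous.integrable_of_hasCompactSupport hc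
        (μ := (densityMeasure Ω u).map (· - h))).comp_measurable (by fun_prop)) fun y => ?_
    by_cases hy : y ∈ V
    · simpa [hy] using (hψI (y - h)).2
    · have : y - h ∉ tsupport ψ := fun hmem => hy (by simpa using (hsupp hmem).2)
      simp [hy, image_eq_zero_of_notMem_tsupport this]
  calc densityMeasure Ω u S = ENNReal.ofReal ((densityMeasure Ω u).real S) :=
        (ofReal_measureReal).symm
    _ ≤ ENNReal.ofReal ((densityMeasure Ω u).real V + ‖h‖ * m.real univ) :=
        ENNReal.ofReal_le_ofReal (by linarith)
    _ = densityMeasure Ω u V + ‖h‖ₑ * m univ := by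
        rw [ENNReal.ofReal_add measureReal_nonneg (by positivity), ofReal_measureReal,
          ENNReal.ofReal_mul (norm_nonneg h), ofReal_norm, ofReal_measureReal]
    _ ≤ densityMeasure Ω u ((· - h) ⁻¹' S) + ‖h‖ₑ * m univ + η := by
        rw [add_right_comm]; gcongr

lemma MemBV.isPolarDerivative (hu : MemBV Ω u) :
    IsPolarDerivative Ω u (variationMeasure Ω u) (polarField Ω u) := by
  simpa only [variationMeasure, polarField, dif_pos hu] using hu.2.choose_spec.choose_spec

lemma MemBV.densityMeasure_le_add (hu : MemBV Ω u) (hu0 : ∀ᵐ x ∂volume.restrict Ω, 0 ≤ u x)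
    (hΩ : IsOpen Ω) (hS : MeasurableSet S) (hSh : S ⊆ segmentDomain Ω h) :
    densityMeasure Ω u S ≤
      densityMeasure Ω u ((· - h) ⁻¹' S) + ‖h‖ₑ * variationMeasure Ω u univ := by
  have := isFiniteMeasure_densityMeasure hu.1
  rw [hS.measure_eq_iSup_isCompact]
  refine iSup₂_le fun L hLS => iSup_le fun hL => ?_
  refine (hu.isPolarDerivative.densityMeasure_le_add_of_isCompact hΩ hu.1 hu0 hL
    (hLS.trans hSh)).trans ?_
  gcongr

end BoundedVariation

section EssentialClosure

lemma mem_thickening_support_iff {X : Type*} [PseudoMetricSpace X] [HereditarilyLindelofSpace X]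
    [MeasurableSpace X] {μ : Measure X} {r : ℝ} {x : X} :
    x ∈ Metric.thickening r μ.support ↔ μ (Metric.ball x r) ≠ 0 := by
  rw [Metric.mem_thickening_iff]
  constructor
  · rintro ⟨z, hz, hxz⟩
    rw [dist_comm] at hxz
    exact ((Measure.mem_support_iff_forall z).1 hz _ (Metric.isOpen_ball.mem_nhds hxz)).ne'
  · intro h
    obtain ⟨z, hzx, hz⟩ := Measure.nonempty_inter_support_of_pos (pos_iff_ne_zero.2 h)
    exact ⟨z, hz, by rwa [dist_comm]⟩

variable {X : Type*} [PseudoMetricSpace X] [MeasureSpace X]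

/-- The essential closure of `A`: the points all of whose neighbourhoods meet `A` in positive
measure. Unlike the closure, it does not change when `A` is modified on a null set. -/
def essClosure (A : Set X) : Set X := (volume.restrict A).support

lemma diff_essClosure_subset [OpensMeasurableSpace X] [(volume : Measure X).IsOpenPosMeasure]
    {U : Set X} (hU : IsOpen U) (A : Set X) : U \ essClosure A ⊆ essClosure (U \ A) := by
  have hUsupp : U ⊆ (volume.restrict U).support := by
    simpa [hU.interior_eq, Measure.support_eq_univ] using
      Measure.interior_inter_support (μ := volume) (s := U)
  have hle : volume.restrict U ≤ volume.restrict A + volume.restrict (U \ A) :=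
    (Measure.restrict_mono (by simp) le_rfl).trans (Measure.restrict_union_le A (U \ A))
  rw [sdiff_subset_iff]
  exact hUsupp.trans ((Measure.support_mono hle).trans (Measure.support_add _ _).subset)

variable [HereditarilyLindelofSpace X]

lemma ae_mem_essClosure (A : Set X) : ∀ᵐ x, x ∈ A → x ∈ essClosure A :=
  ae_imp_of_ae_restrict Measure.support_mem_ae

variable [OpensMeasurableSpace X] {x : X} {r : ℝ}

lemma mem_thickening_essClosure_iff {A : Set X} :
    x ∈ Metric.thickening r (essClosure A) ↔ volume (A ∩ Metric.ball x r) ≠ 0 := by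
  rw [essClosure, mem_thickening_support_iff, Measure.restrict_apply measurableSet_ball, inter_comm]

lemma thickening_essClosure_subset (A : Set X) (r : ℝ) :
    Metric.thickening r (essClosure A) ⊆ Metric.thickening r A := by
  intro x hx
  obtain ⟨y, hyA, hy⟩ := nonempty_of_measure_ne_zero (mem_thickening_essClosure_iff.1 hx)
  exact Metric.mem_thickening_iff.2 ⟨y, hyA, by rwa [dist_comm]⟩

end EssentialClosure

section EssentialBounds

variable {X : Type*} [MeasurableSpace X] {μ : Measure X}

open Classical in
lemma essSup_indicator_one (hμ : μ ≠ 0) (A : Set X) :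
    essSup (A.indicator fun _ => (1 : ℝ)) μ = if μ A = 0 then 0 else 1 := by
  have : NeBot (ae μ) := ae_neBot.2 hμ
  split_ifs with h
  · rw [essSup_congr_ae (indicator_meas_zero h)]
    exact essSup_const _ hμ
  have hle : ∀ x, A.indicator (fun _ => (1 : ℝ)) x ≤ 1 := indicator_le_self' (by simp)
  refine le_antisymm (limsup_le_of_le (isCoboundedUnder_le_of_le _ (x := 0)
    (indicator_nonneg (by simp))) (Eventually.of_forall hle)) ?_
  refine le_limsup_of_frequently_le (fun hnot => h (measure_mono_null (fun x hx => ?_) hnot))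
    (isBoundedUnder_of ⟨1, hle⟩)
  simp [hx]

open Classical in
lemma essInf_indicator_one (hμ : μ ≠ 0) (A : Set X) :
    essInf (A.indicator fun _ => (1 : ℝ)) μ = if μ Aᶜ = 0 then 1 else 0 := by
  have : NeBot (ae μ) := ae_neBot.2 hμ
  split_ifs with h
  · rw [essInf_congr_ae (g := fun _ => 1) (mem_of_superset h fun x hx => ?_)]
    · exact essInf_const _ hμ
    simp_all
  have hge : ∀ x, 0 ≤ A.indicator (fun _ => (1 : ℝ)) x := indicator_nonneg (by simp)
  refine le_antisymm ?_ (le_liminf_of_le (isCoboundedUnder_ge_of_le _ (x := 1)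
    (indicator_le_self' (by simp))) (Eventually.of_forall hge))
  refine liminf_le_of_frequently_le (fun hnot => h (measure_mono_null (fun x hx => ?_) hnot))
    (isBoundedUnder_of ⟨0, hge⟩)
  simp_all

variable {d : ℕ} {Ω A : Set (E d)} {x : E d} {ε : ℝ}

lemma restrict_ball_inter_ne_zero (hΩ : IsOpen Ω) (hε : 0 < ε) (hx : x ∈ Ω) :
    volume.restrict (Metric.ball x ε ∩ Ω) ≠ 0 := fun h =>
  ((Metric.isOpen_ball.inter hΩ).measure_pos volume ⟨x, Metric.mem_ball_self hε, hx⟩).ne'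
    (Measure.restrict_eq_zero.1 h)

lemma essSup_chi (hΩ : IsOpen Ω) (hA : MeasurableSet A) (hAΩ : A ⊆ Ω) (hε : 0 < ε) (hx : x ∈ Ω) :
    essSup (chi A) (volume.restrict (Metric.ball x ε ∩ Ω)) =
      chi (Metric.thickening ε (essClosure A)) x := by
  classical
  have hset : A ∩ (Metric.ball x ε ∩ Ω) = A ∩ Metric.ball x ε := by
    rw [inter_comm _ Ω, ← inter_assoc, inter_eq_left.2 hAΩ]
  rw [chi, essSup_indicator_one (restrict_ball_inter_ne_zero hΩ hε hx), Measure.restrict_apply hA,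
    hset, chi, indicator_apply]
  simp only [mem_thickening_essClosure_iff, ite_not]

lemma essInf_chi (hΩ : IsOpen Ω) (hA : MeasurableSet A) (hε : 0 < ε) (hx : x ∈ Ω) :
    essInf (chi A) (volume.restrict (Metric.ball x ε ∩ Ω)) =
      1 - chi (Metric.thickening ε (essClosure (Ω \ A))) x := by
  classical
  have hset : Aᶜ ∩ (Metric.ball x ε ∩ Ω) = (Ω \ A) ∩ Metric.ball x ε := by
    rw [sdiff_eq, inter_comm _ Ω, ← inter_assoc, inter_comm Aᶜ]
  rw [chi, essInf_indicator_one (restrict_ball_inter_ne_zero hΩ hε hx),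
    Measure.restrict_apply hA.compl, hset, chi, indicator_apply]
  simp only [mem_thickening_essClosure_iff, ite_not]
  split_ifs <;> simp

end EssentialBounds

section Risk

variable {d : ℕ} {Ω A B S T : Set (E d)} {ρ ρ₀ ρ₁ : E d → ℝ} {ε : ℝ}

lemma densityMeasure_le_of_ae_imp (h : ∀ᵐ x, x ∈ S → x ∈ T) :
    densityMeasure Ω ρ S ≤ densityMeasure Ω ρ T :=
  measure_mono_ae ((withDensity_absolutelyContinuous _ _).ae_le (ae_restrict_of_ae h))

lemma densityMeasure_compl (hΩ : MeasurableSet Ω) (A : Set (E d)) :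
    densityMeasure Ω ρ Aᶜ = densityMeasure Ω ρ (Ω \ A) := by
  refine measure_congr ((withDensity_absolutelyContinuous _ _).ae_le ?_)
  filter_upwards [ae_restrict_mem hΩ] with x hx
  exact propext ⟨fun h => ⟨hx, h⟩, fun h => h.2⟩

lemma densityMeasure_le_eLpNormEssSup_mul (S : Set (E d)) :
    densityMeasure Ω ρ S ≤ eLpNormEssSup ρ (volume.restrict Ω) * volume S := by
  have hle : densityMeasure Ω ρ ≤ eLpNormEssSup ρ (volume.restrict Ω) • volume.restrict Ω := by
    rw [densityMeasure, ← withDensity_const]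
    refine withDensity_mono ?_
    filter_upwards [ae_le_eLpNormEssSup (f := ρ) (μ := volume.restrict Ω)] with x hx
    exact (Real.ofReal_le_enorm _).trans hx
  refine (hle S).trans ?_
  rw [Measure.smul_apply, smul_eq_mul]
  gcongr
  exact Measure.restrict_le_self

lemma lintegral_dataMeasure (f : E d × Fin 2 → ℝ≥0∞) :
    ∫⁻ z, f z ∂(dataMeasure Ω ρ₀ ρ₁) =
      ∫⁻ x, f (x, 0) ∂(densityMeasure Ω ρ₀) + ∫⁻ x, f (x, 1) ∂(densityMeasure Ω ρ₁) := by
  rw [dataMeasure, lintegral_add_measure, (measurableEmbedding_prod_mk_right 0).lintegral_map,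
    (measurableEmbedding_prod_mk_right 1).lintegral_map]

lemma loss_zero (A : Set (E d)) (x : E d) : loss A x 0 = A.indicator 1 x := by
  by_cases h : x ∈ A <;> simp [loss, chi, h]

lemma loss_one (A : Set (E d)) (x : E d) : loss A x 1 = Aᶜ.indicator 1 x := by
  by_cases h : x ∈ A <;> simp [loss, chi, h]

lemma iSup_ball_inter_indicator_one (Ω S : Set (E d)) (ε : ℝ) (x : E d) :
    ⨆ x' ∈ Metric.ball x ε ∩ Ω, S.indicator (1 : E d → ℝ≥0∞) x' =
      (Metric.thickening ε (Ω ∩ S)).indicator 1 x := by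
  by_cases h : x ∈ Metric.thickening ε (Ω ∩ S)
  · rw [indicator_of_mem h]
    obtain ⟨z, hz, hxz⟩ := Metric.mem_thickening_iff.1 h
    refine le_antisymm (iSup₂_le fun y _ => indicator_le_self' (by simp) y) ?_
    refine le_iSup₂_of_le z ⟨by rwa [Metric.mem_ball, dist_comm], hz.1⟩ ?_
    simp [hz.2]
  · rw [indicator_of_notMem h]
    refine le_antisymm (iSup₂_le fun y hy => ?_) zero_le
    rw [indicator_of_notMem]
    exact fun hyS => h (Metric.mem_thickening_iff.2 ⟨y, ⟨hy.2, hyS⟩, Metric.mem_ball'.1 hy.1⟩)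

lemma standardRisk_eq (hA : MeasurableSet A) :
    standardRisk Ω ρ₀ ρ₁ A = densityMeasure Ω ρ₀ A + densityMeasure Ω ρ₁ Aᶜ := by
  simp only [standardRisk, lintegral_dataMeasure, loss_zero, loss_one]
  rw [lintegral_indicator_one hA, lintegral_indicator_one hA.compl]

lemma adversarialRisk_eq (A : Set (E d)) :
    adversarialRisk Ω ρ₀ ρ₁ ε A = densityMeasure Ω ρ₀ (Metric.thickening ε (Ω ∩ A)) +
      densityMeasure Ω ρ₁ (Metric.thickening ε (Ω \ A)) := by
  simp only [adversarialRisk, lintegral_dataMeasure, loss_zero, loss_one,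
    iSup_ball_inter_indicator_one]
  rw [lintegral_indicator_one Metric.isOpen_thickening.measurableSet,
    lintegral_indicator_one Metric.isOpen_thickening.measurableSet, sdiff_eq]

lemma standardRisk_ne_top (hρ₀ : IntegrableOn ρ₀ Ω) (hρ₁ : IntegrableOn ρ₁ Ω)
    (hA : MeasurableSet A) : standardRisk Ω ρ₀ ρ₁ A ≠ ∞ := by
  have := isFiniteMeasure_densityMeasure hρ₀
  have := isFiniteMeasure_densityMeasure hρ₁
  rw [standardRisk_eq hA]
  exact ENNReal.add_ne_top.2 ⟨measure_ne_top _ _, measure_ne_top _ _⟩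

lemma standardRisk_le_add_mul_symmDiff (hA : MeasurableSet A) (hB : MeasurableSet B) :
    standardRisk Ω ρ₀ ρ₁ B ≤ standardRisk Ω ρ₀ ρ₁ A +
      (eLpNormEssSup ρ₀ (volume.restrict Ω) + eLpNormEssSup ρ₁ (volume.restrict Ω)) *
        volume (symmDiff A B) := by
  have hle : ∀ (ρ : E d → ℝ) {S T : Set (E d)}, T \ S ⊆ symmDiff A B → densityMeasure Ω ρ T ≤
      densityMeasure Ω ρ S + eLpNormEssSup ρ (volume.restrict Ω) * volume (symmDiff A B) :=
    fun ρ S T h => calc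
      densityMeasure Ω ρ T ≤ densityMeasure Ω ρ (S ∪ symmDiff A B) :=
        measure_mono (sdiff_subset_iff.1 h)
      _ ≤ densityMeasure Ω ρ S + densityMeasure Ω ρ (symmDiff A B) := measure_union_le _ _
      _ ≤ _ := by gcongr; exact densityMeasure_le_eLpNormEssSup_mul _
  rw [standardRisk_eq hA, standardRisk_eq hB, add_mul, add_add_add_comm]
  refine add_le_add (hle ρ₀ subset_union_right) (hle ρ₁ ?_)
  rw [compl_sdiff_compl]
  exact subset_union_left

end Risk

section Energy

variable {d : ℕ} {Ω A A₀ B S T : Set (E d)} {ρ ρ₀ ρ₁ : E d → ℝ} {ε : ℝ}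

/-- The adversarial risk of `A` with the suprema over balls replaced by essential suprema. It is
insensitive to null sets and splits into the standard risk and the nonlocal perimeter. -/
noncomputable def essAdversarialRisk (Ω : Set (E d)) (ρ₀ ρ₁ : E d → ℝ) (ε : ℝ)
    (A : Set (E d)) : ℝ≥0∞ :=
  densityMeasure Ω ρ₀ (Metric.thickening ε (essClosure A)) +
    densityMeasure Ω ρ₁ (Metric.thickening ε (essClosure (Ω \ A)))

lemma essAdversarialRisk_le_adversarialRisk (hAΩ : A ⊆ Ω) :
    essAdversarialRisk Ω ρ₀ ρ₁ ε A ≤ adversarialRisk Ω ρ₀ ρ₁ ε A := by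
  rw [adversarialRisk_eq, inter_eq_right.2 hAΩ]
  exact add_le_add (measure_mono (thickening_essClosure_subset A ε))
    (measure_mono (thickening_essClosure_subset (Ω \ A) ε))

lemma adversarialRisk_inter_essClosure_le (hΩ : IsOpen Ω) (A : Set (E d)) :
    adversarialRisk Ω ρ₀ ρ₁ ε (Ω ∩ essClosure A) ≤ essAdversarialRisk Ω ρ₀ ρ₁ ε A := by
  rw [adversarialRisk_eq, sdiff_self_inter, ← inter_assoc, inter_self]
  exact add_le_add (measure_mono (Metric.thickening_subset_of_subset ε inter_subset_right))
    (measure_mono (Metric.thickening_subset_of_subset ε (diff_essClosure_subset hΩ A)))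

lemma IsAdversarialSolution.essAdversarialRisk_le (hA : IsAdversarialSolution Ω ρ₀ ρ₁ ε A)
    (hΩ : IsOpen Ω) (B : Set (E d)) :
    essAdversarialRisk Ω ρ₀ ρ₁ ε A ≤ essAdversarialRisk Ω ρ₀ ρ₁ ε B :=
  calc essAdversarialRisk Ω ρ₀ ρ₁ ε A ≤ adversarialRisk Ω ρ₀ ρ₁ ε A :=
        essAdversarialRisk_le_adversarialRisk hA.1.2
    _ ≤ adversarialRisk Ω ρ₀ ρ₁ ε (Ω ∩ essClosure B) :=
        hA.2 _ (hΩ.measurableSet.inter Measure.isClosed_support.measurableSet) inter_subset_left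
    _ ≤ essAdversarialRisk Ω ρ₀ ρ₁ ε B := adversarialRisk_inter_essClosure_le hΩ B

lemma lintegral_chi_sub_chi_mul (hS : MeasurableSet S) (hT : MeasurableSet T)
    (hρ : ∀ᵐ x ∂volume.restrict Ω, 0 ≤ ρ x) :
    ∫⁻ x in Ω, ENNReal.ofReal ((chi T x - chi S x) * ρ x) = densityMeasure Ω ρ (T \ S) := by
  rw [densityMeasure, withDensity_apply _ (hT.diff hS), ← lintegral_indicator (hT.diff hS)]
  refine lintegral_congr_ae ?_
  filter_upwards [hρ] with x hx
  by_cases h1 : x ∈ T <;> by_cases h2 : x ∈ S <;> simp [chi, h1, h2, hx]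

lemma ofReal_mul_nonlocalPerimeter (hΩ : IsOpen Ω) (hA : MeasurableSet A) (hAΩ : A ⊆ Ω)
    (hε : 0 < ε) (hρ₀ : ∀ᵐ x ∂volume.restrict Ω, 0 ≤ ρ₀ x)
    (hρ₁ : ∀ᵐ x ∂volume.restrict Ω, 0 ≤ ρ₁ x) :
    ENNReal.ofReal ε * nonlocalPerimeter Ω ρ₀ ρ₁ ε A =
      densityMeasure Ω ρ₀ (Metric.thickening ε (essClosure A) \ A) +
        densityMeasure Ω ρ₁ (Metric.thickening ε (essClosure (Ω \ A)) \ (Ω \ A)) := by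
  have hmeas : ∀ S : Set (E d), MeasurableSet (Metric.thickening ε (essClosure S)) := fun S =>
    Metric.isOpen_thickening.measurableSet
  rw [nonlocalPerimeter, ← mul_add, ← mul_assoc, ← ENNReal.ofReal_mul hε.le,
    mul_inv_cancel₀ hε.ne', ENNReal.ofReal_one, one_mul,
    ← lintegral_chi_sub_chi_mul hA (hmeas _) hρ₀,
    ← lintegral_chi_sub_chi_mul (hΩ.measurableSet.diff hA) (hmeas _) hρ₁]
  congr 1
  · refine setLIntegral_congr_fun hΩ.measurableSet fun x hx => ?_
    simp only [essSup_chi hΩ hA hAΩ hε hx]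
  · refine setLIntegral_congr_fun hΩ.measurableSet fun x hx => ?_
    have hcompl : chi A x = 1 - chi (Ω \ A) x := by by_cases h : x ∈ A <;> simp [chi, h, hx]
    simp only [essInf_chi hΩ hA hε hx, hcompl, sub_sub_sub_cancel_left]

lemma densityMeasure_add_thickening_essClosure_diff (hε : 0 < ε) (hA : MeasurableSet A) :
    densityMeasure Ω ρ A + densityMeasure Ω ρ (Metric.thickening ε (essClosure A) \ A) =
      densityMeasure Ω ρ (Metric.thickening ε (essClosure A)) := by
  rw [← measure_union disjoint_sdiff_right (Metric.isOpen_thickening.measurableSet.diff hA),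
    union_sdiff_self]
  refine le_antisymm (densityMeasure_le_of_ae_imp ?_) (measure_mono subset_union_right)
  filter_upwards [ae_mem_essClosure A] with x hx h
  exact h.elim (fun hxA => Metric.self_subset_thickening hε _ (hx hxA)) id

lemma standardRisk_add_ofReal_mul_nonlocalPerimeter (hΩ : IsOpen Ω) (hA : MeasurableSet A)
    (hAΩ : A ⊆ Ω) (hε : 0 < ε) (hρ₀ : ∀ᵐ x ∂volume.restrict Ω, 0 ≤ ρ₀ x)
    (hρ₁ : ∀ᵐ x ∂volume.restrict Ω, 0 ≤ ρ₁ x) :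
    standardRisk Ω ρ₀ ρ₁ A + ENNReal.ofReal ε * nonlocalPerimeter Ω ρ₀ ρ₁ ε A =
      essAdversarialRisk Ω ρ₀ ρ₁ ε A := by
  rw [standardRisk_eq hA, densityMeasure_compl hΩ.measurableSet,
    ofReal_mul_nonlocalPerimeter hΩ hA hAΩ hε hρ₀ hρ₁, add_add_add_comm,
    densityMeasure_add_thickening_essClosure_diff hε hA,
    densityMeasure_add_thickening_essClosure_diff hε (hΩ.measurableSet.diff hA),
    essAdversarialRisk]

lemma IsAdversarialSolution.ofReal_mul_nonlocalPerimeter_le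
    (hA : IsAdversarialSolution Ω ρ₀ ρ₁ ε A) (hA₀ : IsBayesClassifier Ω ρ₀ ρ₁ A₀)
    (hΩ : IsOpen Ω) (hρ₀ : ∀ᵐ x ∂volume.restrict Ω, 0 ≤ ρ₀ x)
    (hρ₁ : ∀ᵐ x ∂volume.restrict Ω, 0 ≤ ρ₁ x) (hi₀ : IntegrableOn ρ₀ Ω) (hi₁ : IntegrableOn ρ₁ Ω)
    (hε : 0 < ε) (hB : MeasurableSet B) (hBΩ : B ⊆ Ω) :
    ENNReal.ofReal ε * nonlocalPerimeter Ω ρ₀ ρ₁ ε A ≤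
      (eLpNormEssSup ρ₀ (volume.restrict Ω) + eLpNormEssSup ρ₁ (volume.restrict Ω)) *
        volume (symmDiff A₀ B) + ENNReal.ofReal ε * nonlocalPerimeter Ω ρ₀ ρ₁ ε B := by
  obtain ⟨hAm, hAΩ⟩ := hA.1
  rw [← ENNReal.add_le_add_iff_left (standardRisk_ne_top hi₀ hi₁ hA₀.1.1), ← add_assoc]
  calc standardRisk Ω ρ₀ ρ₁ A₀ + ENNReal.ofReal ε * nonlocalPerimeter Ω ρ₀ ρ₁ ε A
    _ ≤ standardRisk Ω ρ₀ ρ₁ A + ENNReal.ofReal ε * nonlocalPerimeter Ω ρ₀ ρ₁ ε A := by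
        gcongr; exact hA₀.2 A hAm hAΩ
    _ = essAdversarialRisk Ω ρ₀ ρ₁ ε A :=
        standardRisk_add_ofReal_mul_nonlocalPerimeter hΩ hAm hAΩ hε hρ₀ hρ₁
    _ ≤ essAdversarialRisk Ω ρ₀ ρ₁ ε B := hA.essAdversarialRisk_le hΩ B
    _ = standardRisk Ω ρ₀ ρ₁ B + ENNReal.ofReal ε * nonlocalPerimeter Ω ρ₀ ρ₁ ε B :=
        (standardRisk_add_ofReal_mul_nonlocalPerimeter hΩ hB hBΩ hε hρ₀ hρ₁).symm
    _ ≤ _ := by gcongr; exact standardRisk_le_add_mul_symmDiff hA₀.1.1 hB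

lemma exists_eventually_nonlocalPerimeter_le {ε : ℕ → ℝ} {A B : ℕ → Set (E d)} (hΩ : IsOpen Ω)
    (hvol : volume Ω ≠ ∞) (hρ₀ : ∀ᵐ x ∂volume.restrict Ω, 0 ≤ ρ₀ x)
    (hρ₁ : ∀ᵐ x ∂volume.restrict Ω, 0 ≤ ρ₁ x)
    (hbdd₀ : MemLp ρ₀ ∞ (volume.restrict Ω)) (hbdd₁ : MemLp ρ₁ ∞ (volume.restrict Ω))
    (hε : ∀ k, 0 < ε k) (hA₀ : IsBayesClassifier Ω ρ₀ ρ₁ A₀)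
    (hB : ∀ k, MeasurableSet (B k) ∧ B k ⊆ Ω)
    (hPer : limsup (fun k => nonlocalPerimeter Ω ρ₀ ρ₁ (ε k) (B k)) atTop < ∞)
    (hdist : (fun k => volume.real (symmDiff A₀ (B k))) =O[atTop] ε)
    (hA : ∀ k, IsAdversarialSolution Ω ρ₀ ρ₁ (ε k) (A k)) :
    ∃ M : ℝ≥0, ∀ᶠ k in atTop, nonlocalPerimeter Ω ρ₀ ρ₁ (ε k) (A k) ≤ M := by
  have : IsFiniteMeasure (volume.restrict Ω) := isFiniteMeasure_restrict.2 hvol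
  obtain ⟨M, hM, -⟩ := ENNReal.lt_iff_exists_nnreal_btwn.1 hPer
  obtain ⟨C, hC⟩ := hdist.bound
  set D := eLpNormEssSup ρ₀ (volume.restrict Ω) + eLpNormEssSup ρ₁ (volume.restrict Ω) with hD
  have hDtop : D ≠ ∞ := by
    simpa [hD] using And.intro hbdd₀.eLpNorm_ne_top hbdd₁.eLpNorm_ne_top
  refine ⟨D.toNNReal * C.toNNReal + M, ?_⟩
  filter_upwards [eventually_lt_of_limsup_lt hM, hC] with k hPerk hdistk
  have hsymm : volume (symmDiff A₀ (B k)) ≤ ENNReal.ofReal C * ENNReal.ofReal (ε k) := by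
    rw [← ofReal_measureReal (measure_ne_top_of_subset
      (symmDiff_subset_union.trans (union_subset hA₀.1.2 (hB k).2)) hvol),
      ← ENNReal.ofReal_mul' (hε k).le]
    exact ENNReal.ofReal_le_ofReal
      (by simpa [abs_of_pos (hε k), abs_of_nonneg measureReal_nonneg] using hdistk)
  have hε0 : ENNReal.ofReal (ε k) ≠ 0 := (ENNReal.ofReal_pos.2 (hε k)).ne'
  rw [← ENNReal.mul_le_mul_iff_right hε0 ENNReal.ofReal_ne_top]
  refine ((hA k).ofReal_mul_nonlocalPerimeter_le hA₀ hΩ hρ₀ hρ₁ (hbdd₀.integrable le_top)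
    (hbdd₁.integrable le_top) (hε k) (hB k).1 (hB k).2).trans ?_
  calc D * volume (symmDiff A₀ (B k)) +
        ENNReal.ofReal (ε k) * nonlocalPerimeter Ω ρ₀ ρ₁ (ε k) (B k)
    _ ≤ D * (ENNReal.ofReal C * ENNReal.ofReal (ε k)) + ENNReal.ofReal (ε k) * M := by gcongr
    _ = ENNReal.ofReal (ε k) * (D.toNNReal * C.toNNReal + M : ℝ≥0) := by
        push_cast
        rw [ENNReal.coe_toNNReal hDtop, ENNReal.ofReal]
        ring

end Energy

section FlipSet

/-- The points whose membership in `A` changes under translation by `h`. Its measure is the `L¹`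
modulus of continuity of the indicator of `A`. -/
def flipSet {G : Type*} [Add G] (A : Set G) (h : G) : Set G := symmDiff A ((· + h) ⁻¹' A)

lemma flipSet_nsmul_subset {G : Type*} [AddMonoid G] (A : Set G) (h : G) (n : ℕ) :
    flipSet A (n • h) ⊆ ⋃ j ∈ Finset.range n, (· + j • h) ⁻¹' flipSet A h := by
  induction n with
  | zero => simp [flipSet]
  | succ n ih =>
    rw [Finset.range_add_one, Finset.set_biUnion_insert, union_comm]
    refine (symmDiff_triangle _ ((· + n • h) ⁻¹' A) _).trans (union_subset_union ih ?_)
    rw [flipSet, preimage_symmDiff, preimage_preimage]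
    simp only [succ_nsmul, add_assoc, subset_rfl]

lemma measure_inter_flipSet_nsmul_le {G : Type*} [AddGroup G] [MeasurableSpace G]
    [MeasurableAdd G] (μ : Measure G) [μ.IsAddRightInvariant] (K A : Set G) (h : G) (n : ℕ) :
    μ (K ∩ flipSet A (n • h)) ≤
      ∑ j ∈ Finset.range n, μ ((· - j • h) ⁻¹' K ∩ flipSet A h) := by
  refine (measure_mono (t := ⋃ j ∈ Finset.range n, (· + j • h) ⁻¹'
    ((· - j • h) ⁻¹' K ∩ flipSet A h)) ?_).trans ((measure_biUnion_finset_le _ _).trans_eq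
      (Finset.sum_congr rfl fun j _ => measure_preimage_add_right μ _ _))
  simp only [preimage_inter, preimage_preimage, add_sub_cancel_right, preimage_id',
    ← inter_iUnion]
  exact inter_subset_inter_right K (flipSet_nsmul_subset A h n)

end FlipSet

section FlipEstimate

lemma exists_nsmul_eq_norm_lt {F : Type*} [NormedAddCommGroup F] [NormedSpace ℝ F] {ε : ℝ}
    (hε : 0 < ε) (h : F) :
    ∃ (n : ℕ) (g : F), n • g = h ∧ n * ‖g‖ = ‖h‖ ∧ ‖g‖ < ε ∧ n * ε ≤ ‖h‖ + ε := by
  set n : ℕ := ⌊‖h‖ / ε⌋₊ + 1 with hn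
  have hn0 : (0 : ℝ) < n := by positivity
  have hfloor := Nat.floor_le (div_nonneg (norm_nonneg h) hε.le)
  have hlt : ‖h‖ / ε < n := by simpa [hn] using Nat.lt_floor_add_one (‖h‖ / ε)
  rw [le_div_iff₀ hε] at hfloor
  rw [div_lt_iff₀ hε] at hlt
  have hnorm : ‖(n : ℝ)⁻¹ • h‖ = (n : ℝ)⁻¹ * ‖h‖ := norm_smul_of_nonneg (by positivity) h
  refine ⟨n, (n : ℝ)⁻¹ • h, ?_, ?_, ?_, ?_⟩
  · rw [← Nat.cast_smul_eq_nsmul ℝ, smul_inv_smul₀ hn0.ne']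
  · rw [hnorm, mul_inv_cancel_left₀ hn0.ne']
  · rwa [hnorm, inv_mul_lt_iff₀ hn0]
  · simpa [hn, add_mul] using hfloor

variable {d : ℕ} {Ω A K P Q S : Set (E d)} {ρ₀ ρ₁ : E d → ℝ} {c ε : ℝ} {h : E d}

lemma ofReal_mul_volume_le_densityMeasure_add (hρ₀ : AEMeasurable ρ₀ (volume.restrict Ω))
    (hc : ∀ᵐ x ∂volume.restrict Ω, c ≤ ρ₀ x + ρ₁ x) (hS : MeasurableSet S) (hSΩ : S ⊆ Ω) :
    ENNReal.ofReal c * volume S ≤ densityMeasure Ω ρ₀ S + densityMeasure Ω ρ₁ S := by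
  rw [densityMeasure, densityMeasure, withDensity_apply _ hS, withDensity_apply _ hS,
    Measure.restrict_restrict_of_subset hSΩ, ← lintegral_add_left'
      (hρ₀.mono_measure (Measure.restrict_mono hSΩ le_rfl)).ennreal_ofReal, ← setLIntegral_const]
  refine lintegral_mono_ae ?_
  filter_upwards [ae_restrict_of_ae_restrict_of_subset hSΩ hc] with x hx
  exact (ENNReal.ofReal_le_ofReal hx).trans ENNReal.ofReal_add_le

lemma ae_mem_thickening_essClosure (hε : ‖h‖ < ε) (Q : Set (E d)) :
    ∀ᵐ x, x + h ∈ Q → x ∈ Metric.thickening ε (essClosure Q) := by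
  filter_upwards [(measurePreserving_add_right volume h).quasiMeasurePreserving.ae
    (ae_mem_essClosure Q)] with x hx hxQ
  exact Metric.mem_thickening_iff.2 ⟨x + h, hx hxQ, by simpa [dist_eq_norm] using hε⟩

-- At points about to leave `P` the nonlocal perimeter only sees `ρ₀`, at points having left it
-- only `ρ₁`; carrying the `ρ₁`-mass along `h` costs the variation of `ρ₁`, and then `c ≤ ρ₀ + ρ₁`
-- applies.
lemma ofReal_mul_volume_le_of_add_mem (hΩ : IsOpen Ω) (hρ₀ : AEMeasurable ρ₀ (volume.restrict Ω))
    (hρ₁ : MemBV Ω ρ₁) (hρ₁0 : ∀ᵐ x ∂volume.restrict Ω, 0 ≤ ρ₁ x)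
    (hc : ∀ᵐ x ∂volume.restrict Ω, c ≤ ρ₀ x + ρ₁ x) (hε : ‖h‖ < ε) (hS : MeasurableSet S)
    (hSh : S ⊆ segmentDomain Ω h) (hPQ : Disjoint P Q) (hSP : S ⊆ P) (hSQ : ∀ x ∈ S, x + h ∈ Q) :
    ENNReal.ofReal c * volume S ≤
      densityMeasure Ω ρ₀ (Metric.thickening ε (essClosure Q) \ Q) +
        densityMeasure Ω ρ₁ (Metric.thickening ε (essClosure P) \ P) +
        ‖h‖ₑ * variationMeasure Ω ρ₁ univ := by
  have hSΩ : S ⊆ Ω := fun x hx => by simpa using hSh hx 0 (by simp)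
  have hsource : densityMeasure Ω ρ₀ S ≤
      densityMeasure Ω ρ₀ (Metric.thickening ε (essClosure Q) \ Q) := by
    refine densityMeasure_le_of_ae_imp ?_
    filter_upwards [ae_mem_thickening_essClosure hε Q] with x hx hxS
    exact ⟨hx (hSQ x hxS), hPQ.notMem_of_mem_left (hSP hxS)⟩
  have htarget : densityMeasure Ω ρ₁ ((· - h) ⁻¹' S) ≤
      densityMeasure Ω ρ₁ (Metric.thickening ε (essClosure P) \ P) := by
    refine densityMeasure_le_of_ae_imp ?_
    filter_upwards [ae_mem_thickening_essClosure (by rwa [norm_neg]) P (h := -h)] with y hy hyS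
    refine ⟨hy (by simpa [sub_eq_add_neg] using hSP hyS), hPQ.notMem_of_mem_right ?_⟩
    simpa using hSQ _ hyS
  calc ENNReal.ofReal c * volume S ≤ densityMeasure Ω ρ₀ S + densityMeasure Ω ρ₁ S :=
        ofReal_mul_volume_le_densityMeasure_add hρ₀ hc hS hSΩ
    _ ≤ densityMeasure Ω ρ₀ S + (densityMeasure Ω ρ₁ ((· - h) ⁻¹' S) +
          ‖h‖ₑ * variationMeasure Ω ρ₁ univ) := by
        gcongr; exact hρ₁.densityMeasure_le_add hρ₁0 hΩ hS hSh
    _ ≤ _ := by rw [← add_assoc]; gcongr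

lemma ofReal_mul_volume_inter_flipSet_le_of_norm_lt (hΩ : IsOpen Ω) (hρ₀ : MemBV Ω ρ₀)
    (hρ₁ : MemBV Ω ρ₁) (hρ₀0 : ∀ᵐ x ∂volume.restrict Ω, 0 ≤ ρ₀ x)
    (hρ₁0 : ∀ᵐ x ∂volume.restrict Ω, 0 ≤ ρ₁ x)
    (hc : ∀ᵐ x ∂volume.restrict Ω, c ≤ ρ₀ x + ρ₁ x) (hA : MeasurableSet A) (hAΩ : A ⊆ Ω)
    (hε : ‖h‖ < ε) (hK : MeasurableSet K) (hKh : K ⊆ segmentDomain Ω h) :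
    ENNReal.ofReal c * volume (K ∩ flipSet A h) ≤
      2 * (ENNReal.ofReal ε * nonlocalPerimeter Ω ρ₀ ρ₁ ε A) +
        ‖h‖ₑ * (variationMeasure Ω ρ₀ univ + variationMeasure Ω ρ₁ univ) := by
  have hKΩ : K ⊆ Ω := fun x hx => by simpa using hKh hx 0 (by simp)
  have hKΩ' : ∀ x ∈ K, x + h ∈ Ω := fun x hx => by simpa using hKh hx 1 (by simp)
  have hA' : MeasurableSet ((· + h) ⁻¹' A) := measurable_add_const h hA
  have hleave := ofReal_mul_volume_le_of_add_mem (S := K ∩ (A \ (· + h) ⁻¹' A)) hΩ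
    hρ₁.1.aestronglyMeasurable.aemeasurable hρ₀ hρ₀0 (by simpa only [add_comm] using hc) hε
    (hK.inter (hA.diff hA')) (inter_subset_left.trans hKh) disjoint_sdiff_right (fun x hx => hx.2.1)
    (fun x hx => ⟨hKΩ' x hx.1, hx.2.2⟩)
  have henter := ofReal_mul_volume_le_of_add_mem (S := K ∩ ((· + h) ⁻¹' A \ A)) hΩ
    hρ₀.1.aestronglyMeasurable.aemeasurable hρ₁ hρ₁0 hc hε
    (hK.inter (hA'.diff hA)) (inter_subset_left.trans hKh) disjoint_sdiff_left
    (fun x hx => ⟨hKΩ hx.1, hx.2.2⟩) (fun x hx => hx.2.1)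
  rw [ofReal_mul_nonlocalPerimeter hΩ hA hAΩ ((norm_nonneg h).trans_lt hε) hρ₀0 hρ₁0]
  calc ENNReal.ofReal c * volume (K ∩ flipSet A h)
    _ ≤ ENNReal.ofReal c * volume (K ∩ (A \ (· + h) ⁻¹' A)) +
          ENNReal.ofReal c * volume (K ∩ ((· + h) ⁻¹' A \ A)) := by
        rw [← mul_add, flipSet, Set.symmDiff_def, inter_union_distrib_left]
        gcongr
        exact measure_union_le _ _
    _ ≤ _ := add_le_add hleave henter
    _ = _ := by ring

lemma ofReal_mul_volume_inter_flipSet_le (hΩ : IsOpen Ω) (hρ₀ : MemBV Ω ρ₀)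
    (hρ₁ : MemBV Ω ρ₁) (hρ₀0 : ∀ᵐ x ∂volume.restrict Ω, 0 ≤ ρ₀ x)
    (hρ₁0 : ∀ᵐ x ∂volume.restrict Ω, 0 ≤ ρ₁ x)
    (hc : ∀ᵐ x ∂volume.restrict Ω, c ≤ ρ₀ x + ρ₁ x) (hA : MeasurableSet A) (hAΩ : A ⊆ Ω)
    (hε : 0 < ε) (hK : MeasurableSet K) (hKh : K ⊆ segmentDomain Ω h) :
    ENNReal.ofReal c * volume (K ∩ flipSet A h) ≤
      (2 * nonlocalPerimeter Ω ρ₀ ρ₁ ε A +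
        (variationMeasure Ω ρ₀ univ + variationMeasure Ω ρ₁ univ)) * ENNReal.ofReal (‖h‖ + ε) := by
  set V := variationMeasure Ω ρ₀ univ + variationMeasure Ω ρ₁ univ
  obtain ⟨n, g, hng, hgh, hgε, hnε⟩ := exists_nsmul_eq_norm_lt hε h
  have hstep : ∀ j ∈ Finset.range n,
      ENNReal.ofReal c * volume ((· - j • g) ⁻¹' K ∩ flipSet A g) ≤
        2 * (ENNReal.ofReal ε * nonlocalPerimeter Ω ρ₀ ρ₁ ε A) + ‖g‖ₑ * V := by
    intro j hj
    refine ofReal_mul_volume_inter_flipSet_le_of_norm_lt hΩ hρ₀ hρ₁ hρ₀0 hρ₁0 hc hA hAΩ hgε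
      (measurable_sub_const _ hK) fun x hx => ?_
    rw [← sub_add_cancel x (j • g)]
    exact add_nsmul_mem_segmentDomain (hng ▸ hKh hx) (Finset.mem_range.1 hj)
  calc ENNReal.ofReal c * volume (K ∩ flipSet A h)
    _ ≤ ∑ j ∈ Finset.range n, ENNReal.ofReal c * volume ((· - j • g) ⁻¹' K ∩ flipSet A g) := by
        rw [← hng, ← Finset.mul_sum]
        gcongr
        exact measure_inter_flipSet_nsmul_le volume K A g n
    _ ≤ n * (2 * (ENNReal.ofReal ε * nonlocalPerimeter Ω ρ₀ ρ₁ ε A) + ‖g‖ₑ * V) := by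
        rw [← nsmul_eq_mul]
        exact (Finset.sum_le_card_nsmul _ _ _ hstep).trans_eq (by rw [Finset.card_range])
    _ = 2 * nonlocalPerimeter Ω ρ₀ ρ₁ ε A * ENNReal.ofReal (n * ε) +
          V * ENNReal.ofReal (n * ‖g‖) := by
        rw [ENNReal.ofReal_mul n.cast_nonneg, ENNReal.ofReal_mul n.cast_nonneg,
          ENNReal.ofReal_natCast, ofReal_norm]
        ring
    _ ≤ 2 * nonlocalPerimeter Ω ρ₀ ρ₁ ε A * ENNReal.ofReal (‖h‖ + ε) +
          V * ENNReal.ofReal (‖h‖ + ε) := by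
        rw [hgh]
        gcongr
        exact le_add_of_nonneg_right hε.le
    _ = _ := (add_mul _ _ _).symm

end FlipEstimate

section SetCompleteness

variable {X : Type*}

lemma symmDiff_limsup_subset (A : ℕ → Set X) (n : ℕ) :
    symmDiff (A n) (limsup A atTop) ⊆ ⋃ i, symmDiff (A (i + n)) (A (i + n + 1)) := by
  intro x hx
  contrapose! hx
  simp only [mem_iUnion, mem_symmDiff, not_exists, not_or, not_and, not_not] at hx
  have hconst : ∀ i, x ∈ A (i + n) ↔ x ∈ A n := by
    intro i
    induction i with
    | zero => rw [zero_add]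
    | succ i ih => rw [← ih, add_right_comm]; exact ⟨(hx i).2, (hx i).1⟩
  have hlimsup : x ∈ limsup A atTop ↔ x ∈ A n := by
    rw [mem_limsup_iff_frequently_mem]
    refine (frequently_congr ?_).trans frequently_const
    filter_upwards [eventually_ge_atTop n] with k hk
    rw [← hconst (k - n), Nat.sub_add_cancel hk]
  simp [mem_symmDiff, hlimsup]

instance instCompleteSpaceMeasuredSets [MeasurableSpace X] (μ : Measure X) :
    CompleteSpace (MeasuredSets μ) := by
  refine EMetric.complete_of_convergent_controlled_sequences (fun n => 2⁻¹ ^ n)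
    (fun n => ENNReal.pow_pos (by simp) n) fun A hA => ?_
  let L : MeasuredSets μ := ⟨limsup (fun n => (A n : Set X)) atTop,
    MeasurableSet.measurableSet_limsup fun n => Subtype.property (A n)⟩
  have hsum : ∑' n, (2⁻¹ : ℝ≥0∞) ^ n ≠ ∞ := by simp [ENNReal.tsum_geometric]
  refine ⟨L, tendsto_iff_edist_tendsto_0.2 ?_⟩
  refine tendsto_of_tendsto_of_tendsto_of_le_of_le tendsto_const_nhds
    (ENNReal.tendsto_sum_nat_add _ hsum) (fun _ => zero_le) fun n => ?_
  calc edist (A n) L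
    _ ≤ ∑' i, edist (A (i + n)) (A (i + n + 1)) :=
        (measure_mono (μ := μ) (symmDiff_limsup_subset (fun k => (A k : Set X)) n)).trans
          (measure_iUnion_le _)
    _ ≤ ∑' i, 2⁻¹ ^ (i + n) :=
        ENNReal.tsum_le_tsum fun i => (hA _ _ _ le_rfl (Nat.le_succ _)).le

end SetCompleteness

section LocalMasses

variable {X : Type*} [MeasurableSpace X]

lemma exists_subseq_tendsto_measureReal_inter [MeasurableSpace.CountablyGenerated X]
    (μ : Measure X) [IsFiniteMeasure μ] {A : ℕ → Set X} (hA : ∀ k, MeasurableSet (A k)) :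
    ∃ φ : ℕ → ℕ, StrictMono φ ∧ ∀ S, MeasurableSet S →
      ∃ l, Tendsto (fun k => μ.real (A (φ k) ∩ S)) atTop (𝓝 l) := by
  have : Fact ((2 : ℝ≥0∞) ≠ ∞) := ⟨ENNReal.ofNat_ne_top⟩
  let χ : ∀ {S : Set X}, MeasurableSet S → Lp ℝ 2 μ := fun hS =>
    indicatorConstLp 2 hS (measure_ne_top μ _) 1
  let T : ℕ → WeakDual ℝ (Lp ℝ 2 μ) := fun k => StrongDual.toWeakDual (innerSL ℝ (χ (hA k)))
  have hT : ∀ k, WeakDual.toStrongDual (T k) ∈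
      Metric.closedBall (0 : StrongDual ℝ (Lp ℝ 2 μ)) (μ.real univ ^ (1 / (2 : ℝ))) := by
    intro k
    rw [mem_closedBall_zero_iff]
    refine (innerSL_apply_norm ℝ (χ (hA k))).trans_le (norm_indicatorConstLp_le.trans ?_)
    rw [norm_one, one_mul, ENNReal.toReal_ofNat]
    exact Real.rpow_le_rpow measureReal_nonneg (measureReal_mono (subset_univ _)) (by positivity)
  obtain ⟨T₀, -, φ, hφ, hT⟩ := WeakDual.isSeqCompact_closedBall ℝ (Lp ℝ 2 μ) 0 _ hT
  refine ⟨φ, hφ, fun S hS => ⟨T₀ (χ hS), ?_⟩⟩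
  exact (((WeakDual.eval_continuous (χ hS)).tendsto T₀).comp hT).congr fun k =>
    L2.real_inner_indicatorConstLp_one_indicatorConstLp_one (hA _) hS

end LocalMasses

section TranslatedMasses

variable {G : Type*} [AddGroup G] {A B : Set G} {x : G}

lemma setOf_mem_flipSet_of_mem (hx : x ∈ A) : {h | x ∈ flipSet A h} = ((x + ·) ⁻¹' A)ᶜ := by
  ext h
  simp [flipSet, mem_symmDiff, hx]

lemma setOf_mem_flipSet_of_notMem (hx : x ∉ A) : {h | x ∈ flipSet A h} = (x + ·) ⁻¹' A := by
  ext h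
  simp [flipSet, mem_symmDiff, hx]

variable [MeasurableSpace G] [MeasurableAdd₂ G]

lemma measurableSet_flipSet (hA : MeasurableSet A) (h : G) : MeasurableSet (flipSet A h) :=
  hA.symmDiff (measurable_add_const h hA)

lemma measurableSet_setOf_mem_flipSet (hA : MeasurableSet A) :
    MeasurableSet {p : G × G | p.1 ∈ flipSet A p.2} :=
  (measurable_fst hA).symmDiff (measurable_add hA)

lemma measurable_measure_setOf_mem_flipSet (ν : Measure G) [SFinite ν] (hA : MeasurableSet A) :
    Measurable fun x => ν {h | x ∈ flipSet A h} :=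
  measurable_measure_prodMk_left (measurableSet_setOf_mem_flipSet hA)

lemma lintegral_measure_setOf_mem_flipSet (μ ν : Measure G) [SFinite μ] [SFinite ν]
    (hA : MeasurableSet A) :
    ∫⁻ x, ν {h | x ∈ flipSet A h} ∂μ = ∫⁻ h, μ (flipSet A h) ∂ν :=
  (Measure.prod_apply (measurableSet_setOf_mem_flipSet hA)).symm.trans
    (Measure.prod_apply_symm (measurableSet_setOf_mem_flipSet hA))

lemma measure_univ_le_of_mem_symmDiff (ν : Measure G) [IsFiniteMeasure ν]
    (hA : MeasurableSet A) (hB : MeasurableSet B) (hx : x ∈ symmDiff A B) :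
    ν univ ≤ ν {h | x ∈ flipSet A h} + ν {h | x ∈ flipSet B h} +
      ‖ν.real ((x + ·) ⁻¹' A) - ν.real ((x + ·) ⁻¹' B)‖ₑ := by
  wlog hxA : x ∈ A generalizing A B with H
  · rw [symmDiff_comm] at hx
    rw [add_comm (ν _), enorm_sub_rev]
    exact H hB hA hx (hx.resolve_right fun h => hxA h.1).1
  have hxB : x ∉ B := (hx.resolve_right fun h => h.2 hxA).2
  rw [setOf_mem_flipSet_of_mem hxA, setOf_mem_flipSet_of_notMem hxB,
    ← measure_add_measure_compl (measurable_const_add x hA), add_comm (ν _), add_assoc]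
  gcongr
  rw [← ofReal_measureReal, ← ofReal_measureReal, Real.enorm_eq_ofReal_abs,
    ← ENNReal.ofReal_add measureReal_nonneg (abs_nonneg _)]
  exact ENNReal.ofReal_le_ofReal (sub_le_iff_le_add'.1 (le_abs_self _))

lemma measure_univ_mul_measure_symmDiff_le (μ ν : Measure G) [SFinite μ] [IsFiniteMeasure ν]
    (hA : MeasurableSet A) (hB : MeasurableSet B) :
    ν univ * μ (symmDiff A B) ≤ ∫⁻ h, μ (flipSet A h) ∂ν + ∫⁻ h, μ (flipSet B h) ∂ν +
      ∫⁻ x, ‖ν.real ((x + ·) ⁻¹' A) - ν.real ((x + ·) ⁻¹' B)‖ₑ ∂μ := by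
  have hmeas : Measurable fun x => ν {h | x ∈ flipSet A h} + ν {h | x ∈ flipSet B h} :=
    (measurable_measure_setOf_mem_flipSet ν hA).add (measurable_measure_setOf_mem_flipSet ν hB)
  rw [← lintegral_measure_setOf_mem_flipSet μ ν hA, ← lintegral_measure_setOf_mem_flipSet μ ν hB,
    ← lintegral_add_left (measurable_measure_setOf_mem_flipSet ν hA), ← lintegral_add_left hmeas,
    ← setLIntegral_const]
  exact (setLIntegral_mono' (hA.symmDiff hB) fun x hx =>
    measure_univ_le_of_mem_symmDiff ν hA hB hx).trans (setLIntegral_le_lintegral _ _)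

lemma tendsto_lintegral_enorm_measureReal_sub (μ ν : Measure G) [IsFiniteMeasure μ]
    [IsFiniteMeasure ν] {A : ℕ → Set G} (hA : ∀ k, MeasurableSet (A k))
    (hlim : ∀ x, ∃ l, Tendsto (fun k => ν.real ((x + ·) ⁻¹' A k)) atTop (𝓝 l)) :
    Tendsto (fun p : ℕ × ℕ =>
        ∫⁻ x, ‖ν.real ((x + ·) ⁻¹' A p.1) - ν.real ((x + ·) ⁻¹' A p.2)‖ₑ ∂μ) atTop (𝓝 0) := by
  have hmeas : ∀ k, Measurable fun x => ν.real ((x + ·) ⁻¹' A k) := fun k =>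
    (measurable_measure_prodMk_left (measurable_add (hA k))).ennreal_toReal
  have hbound : ∀ k x, ‖ν.real ((x + ·) ⁻¹' A k)‖ₑ ≤ ν univ := fun k x => by
    rw [Real.enorm_of_nonneg measureReal_nonneg, ofReal_measureReal]
    exact measure_mono (subset_univ _)
  rw [← lintegral_zero (μ := μ)]
  refine tendsto_lintegral_filter_of_dominated_convergence (fun _ => ν univ + ν univ)
    (Eventually.of_forall fun p => ((hmeas p.1).sub (hmeas p.2)).enorm)
    (Eventually.of_forall fun p => ae_of_all _ fun x =>
      enorm_sub_le.trans (add_le_add (hbound _ _) (hbound _ _)))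
    (by simp [ENNReal.mul_eq_top]) (ae_of_all _ fun x => ?_)
  obtain ⟨l, hl⟩ := hlim x
  rw [← prod_atTop_atTop_eq]
  simpa using ((hl.comp tendsto_fst).sub (hl.comp tendsto_snd)).enorm

end TranslatedMasses

section RieszKolmogorov

variable {G : Type*} [NormedAddCommGroup G] [MeasurableSpace G] [BorelSpace G] [ProperSpace G]
  {μ : Measure G} [μ.IsAddHaarMeasure] {Ω K A B : Set G} {r : ℝ}

omit [ProperSpace G] in
lemma measureReal_restrict_ball_preimage_add (hA : MeasurableSet A) (x : G) :
    (μ.restrict (Metric.ball 0 r)).real ((x + ·) ⁻¹' A) = μ.real (A ∩ Metric.ball x r) := by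
  have hball : Metric.ball (0 : G) r = (x + ·) ⁻¹' Metric.ball x r := by
    ext y
    simp
  rw [measureReal_restrict_apply (measurable_const_add x hA), hball, ← preimage_inter,
    measureReal_def, measure_preimage_add, measureReal_def]

lemma measure_inter_symmDiff_le {δ : ℝ≥0∞} (hr : 0 < r)
    (hA : MeasurableSet A) (hB : MeasurableSet B)
    (hflipA : ∀ h, ‖h‖ < r → μ (K ∩ flipSet A h) ≤ δ)
    (hflipB : ∀ h, ‖h‖ < r → μ (K ∩ flipSet B h) ≤ δ) :
    μ (K ∩ symmDiff A B) ≤ 2 * δ + (μ (Metric.ball 0 r))⁻¹ *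
      ∫⁻ x in K, ‖(μ.restrict (Metric.ball 0 r)).real ((x + ·) ⁻¹' A) -
        (μ.restrict (Metric.ball 0 r)).real ((x + ·) ⁻¹' B)‖ₑ ∂μ := by
  have hfinite : μ (Metric.ball 0 r) ≠ ∞ := Metric.isBounded_ball.measure_lt_top.ne
  have hpos : μ (Metric.ball 0 r) ≠ 0 := (Metric.measure_ball_pos μ 0 hr).ne'
  have : IsFiniteMeasure (μ.restrict (Metric.ball 0 r)) := isFiniteMeasure_restrict.2 hfinite
  have hflip_le : ∀ {S : Set G}, MeasurableSet S → (∀ h, ‖h‖ < r → μ (K ∩ flipSet S h) ≤ δ) →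
      ∫⁻ h in Metric.ball 0 r, μ.restrict K (flipSet S h) ∂μ ≤ δ * μ (Metric.ball 0 r) := by
    intro S hS hflip
    rw [← setLIntegral_const]
    refine setLIntegral_mono' measurableSet_ball fun h hh => ?_
    rw [Measure.restrict_apply (measurableSet_flipSet hS h), inter_comm]
    exact hflip h (mem_ball_zero_iff.1 hh)
  have hmain := measure_univ_mul_measure_symmDiff_le (μ.restrict K) (μ.restrict (Metric.ball 0 r))
    hA hB
  rw [Measure.restrict_apply_univ, Measure.restrict_apply (hA.symmDiff hB), inter_comm] at hmain
  rw [← ENNReal.mul_le_mul_iff_right hpos hfinite, mul_add, ← mul_assoc _ _⁻¹,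
    ENNReal.mul_inv_cancel hpos hfinite, one_mul]
  refine hmain.trans (add_le_add_left ((add_le_add (hflip_le hA hflipA) (hflip_le hB hflipB)).trans
    (by rw [mul_comm, two_mul, mul_add, mul_comm])) _)

lemma cauchySeq_of_measure_inter_flipSet_le (hΩ : μ Ω ≠ ∞) {A : ℕ → MeasuredSets μ}
    (hAΩ : ∀ k, (A k : Set G) ⊆ Ω)
    (hlim : ∀ S, MeasurableSet S → ∃ l, Tendsto (fun k => μ.real (A k ∩ S)) atTop (𝓝 l))
    (hflip : ∀ δ : ℝ≥0∞, δ ≠ 0 → ∃ K ⊆ Ω, μ (Ω \ K) ≤ δ ∧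
      ∃ r > 0, ∀ᶠ k in atTop, ∀ h, ‖h‖ < r → μ (K ∩ flipSet (A k) h) ≤ δ) :
    CauchySeq A := by
  refine EMetric.cauchySeq_iff_NNReal.2 fun η hη => ?_
  have hδ : ((η / 5 : ℝ≥0) : ℝ≥0∞) ≠ 0 := ENNReal.coe_ne_zero.2 (by positivity)
  obtain ⟨K, hKΩ, hΩK, r, hr, hflipK⟩ := hflip _ hδ
  have : IsFiniteMeasure (μ.restrict K) :=
    isFiniteMeasure_restrict.2 (measure_ne_top_of_subset hKΩ hΩ)
  have : IsFiniteMeasure (μ.restrict (Metric.ball 0 r)) :=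
    isFiniteMeasure_restrict.2 Metric.isBounded_ball.measure_lt_top.ne
  have hmass := ENNReal.Tendsto.const_mul (tendsto_lintegral_enorm_measureReal_sub
    (μ.restrict K) (μ.restrict (Metric.ball 0 r)) (fun k => (A k).2) fun x => by
      simp only [measureReal_restrict_ball_preimage_add (A _).2]
      exact hlim _ measurableSet_ball)
    (.inr (ENNReal.inv_ne_top.2 (Metric.measure_ball_pos μ 0 hr).ne'))
  rw [mul_zero] at hmass
  obtain ⟨⟨i, j⟩, hij⟩ := eventually_atTop.1 (hmass.eventually_le_const (pos_iff_ne_zero.2 hδ))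
  obtain ⟨N, hN⟩ := eventually_atTop.1 hflipK
  refine ⟨max N (max i j), fun n hn => ?_⟩
  simp only [max_le_iff] at hn
  have hdiff : symmDiff (A n : Set G) (A (max N (max i j))) ⊆ Ω :=
    symmDiff_subset_union.trans (union_subset (hAΩ _) (hAΩ _))
  calc edist (A n) (A (max N (max i j)))
    _ ≤ μ (K ∩ symmDiff (A n : Set G) (A (max N (max i j)))) + μ (Ω \ K) :=
        (measure_mono fun x hx => (em (x ∈ K)).imp (⟨·, hx⟩) (⟨hdiff hx, ·⟩)).trans
          (measure_union_le _ _)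
    _ ≤ 2 * (η / 5 : ℝ≥0) + (η / 5 : ℝ≥0) + (η / 5 : ℝ≥0) := by
        refine add_le_add ?_ hΩK
        refine (measure_inter_symmDiff_le hr (A _).2 (A _).2 (hN n hn.1)
          (hN _ (le_max_left _ _))).trans (add_le_add_right ?_ _)
        exact hij (n, max N (max i j)) (by simp [hn])
    _ < η := by
        norm_cast
        field_simp
        norm_num

lemma exists_subseq_tendsto_measure_symmDiff (hΩ : MeasurableSet Ω) (hμΩ : μ Ω ≠ ∞)
    {A : ℕ → Set G} (hA : ∀ k, MeasurableSet (A k)) (hAΩ : ∀ k, A k ⊆ Ω)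
    (hflip : ∀ δ : ℝ≥0∞, δ ≠ 0 → ∃ K ⊆ Ω, μ (Ω \ K) ≤ δ ∧
      ∃ r > 0, ∀ᶠ k in atTop, ∀ h, ‖h‖ < r → μ (K ∩ flipSet (A k) h) ≤ δ) :
    ∃ φ : ℕ → ℕ, StrictMono φ ∧ ∃ A₀, MeasurableSet A₀ ∧ A₀ ⊆ Ω ∧
      Tendsto (fun k => μ (symmDiff (A (φ k)) A₀)) atTop (𝓝 0) := by
  have : IsFiniteMeasure (μ.restrict Ω) := isFiniteMeasure_restrict.2 hμΩ
  obtain ⟨φ, hφ, hlim⟩ := exists_subseq_tendsto_measureReal_inter (μ.restrict Ω) hA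
  let s : ℕ → MeasuredSets μ := fun k => ⟨A (φ k), hA (φ k)⟩
  have hs : CauchySeq s := by
    refine cauchySeq_of_measure_inter_flipSet_le hμΩ (fun k => hAΩ (φ k)) (fun S hS => ?_)
      fun δ hδ => ?_
    · obtain ⟨l, hl⟩ := hlim S hS
      refine ⟨l, hl.congr fun k => ?_⟩
      rw [measureReal_restrict_apply ((hA _).inter hS),
        inter_eq_left.2 (inter_subset_left.trans (hAΩ _))]
      rfl
    · obtain ⟨K, hKΩ, hΩK, r, hr, hflipK⟩ := hflip δ hδ
      exact ⟨K, hKΩ, hΩK, r, hr, hφ.tendsto_atTop.eventually hflipK⟩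
  obtain ⟨L, hL⟩ := cauchySeq_tendsto_of_complete hs
  refine ⟨φ, hφ, L ∩ Ω, L.2.inter hΩ, inter_subset_right, ?_⟩
  refine tendsto_of_tendsto_of_tendsto_of_le_of_le tendsto_const_nhds
    (tendsto_iff_edist_tendsto_0.1 hL) (fun _ => zero_le) fun k => measure_mono (μ := μ) ?_
  rintro x (⟨hxA, hxL⟩ | ⟨⟨hxL, -⟩, hxA⟩)
  · exact .inl ⟨hxA, fun hx => hxL ⟨hx, hAΩ _ hxA⟩⟩
  · exact .inr ⟨hxL, hxA⟩

end RieszKolmogorov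

section Precompactness

variable {d : ℕ}

lemma enorm_chi_sub_chi (A B : Set (E d)) (x : E d) :
    ‖chi A x - chi B x‖ₑ = (symmDiff A B).indicator 1 x := by
  by_cases hA : x ∈ A <;> by_cases hB : x ∈ B <;> simp [chi, mem_symmDiff, hA, hB]

lemma eLpNorm_chi_sub_chi {A B : Set (E d)} (hA : MeasurableSet A) (hB : MeasurableSet B)
    (μ : Measure (E d)) : eLpNorm (chi A - chi B) 1 μ = μ (symmDiff A B) := by
  simp only [eLpNorm_one_eq_lintegral_enorm, Pi.sub_apply, enorm_chi_sub_chi]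
  exact lintegral_indicator_one (hA.symmDiff hB)

variable {Ω K : Set (E d)} {ρ₀ ρ₁ : E d → ℝ} {c : ℝ} {M : ℝ≥0} {ε : ℕ → ℝ} {A : ℕ → Set (E d)}

lemma exists_eventually_volume_inter_flipSet_le (hΩ : IsOpen Ω)
    (hρ₀ : MemBV Ω ρ₀) (hρ₁ : MemBV Ω ρ₁) (hρ₀0 : ∀ᵐ x ∂volume.restrict Ω, 0 ≤ ρ₀ x)
    (hρ₁0 : ∀ᵐ x ∂volume.restrict Ω, 0 ≤ ρ₁ x) (hc : 0 < c)
    (hρ : ∀ᵐ x ∂volume.restrict Ω, c ≤ ρ₀ x + ρ₁ x) (hε_pos : ∀ k, 0 < ε k)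
    (hε : Tendsto ε atTop (𝓝 0)) (hA : ∀ k, MeasurableSet (A k) ∧ A k ⊆ Ω)
    (hPer : ∀ᶠ k in atTop, nonlocalPerimeter Ω ρ₀ ρ₁ (ε k) (A k) ≤ M)
    (hK : IsCompact K) (hKΩ : K ⊆ Ω) {δ : ℝ≥0∞} (hδ : δ ≠ 0) :
    ∃ r > 0, ∀ᶠ k in atTop, ∀ h, ‖h‖ < r → volume (K ∩ flipSet (A k) h) ≤ δ := by
  have := hρ₀.isPolarDerivative.isFinite
  have := hρ₁.isPolarDerivative.isFinite
  set D := 2 * (M : ℝ≥0∞) + (variationMeasure Ω ρ₀ univ + variationMeasure Ω ρ₁ univ) with hD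
  have hDtop : D ≠ ∞ := by finiteness
  have hc0 : ENNReal.ofReal c ≠ 0 := (ENNReal.ofReal_pos.2 hc).ne'
  obtain ⟨R, hR, hsegment⟩ := exists_forall_subset_segmentDomain hΩ hK hKΩ
  obtain ⟨s, hs, hDs⟩ := ENNReal.exists_nnreal_pos_mul_lt hDtop (mul_ne_zero hc0 hδ)
  refine ⟨min R (s / 2), by positivity, ?_⟩
  have hε_small : ∀ᶠ k in atTop, ε k < s / 2 := hε.eventually_lt_const (by positivity)
  filter_upwards [hPer, hε_small] with k hPerk hεk h hh
  rw [lt_min_iff] at hh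
  rw [← ENNReal.mul_le_mul_iff_right hc0 ENNReal.ofReal_ne_top]
  calc ENNReal.ofReal c * volume (K ∩ flipSet (A k) h)
    _ ≤ (2 * nonlocalPerimeter Ω ρ₀ ρ₁ (ε k) (A k) +
          (variationMeasure Ω ρ₀ univ + variationMeasure Ω ρ₁ univ)) *
          ENNReal.ofReal (‖h‖ + ε k) :=
        ofReal_mul_volume_inter_flipSet_le hΩ hρ₀ hρ₁ hρ₀0 hρ₁0 hρ (hA k).1 (hA k).2 (hε_pos k)
          hK.measurableSet (hsegment h hh.1)
    _ ≤ D * ENNReal.ofReal s := by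
        rw [hD]
        gcongr
        linarith
    _ ≤ ENNReal.ofReal c * δ := by
        rw [ENNReal.ofReal_coe_nnreal, mul_comm]
        exact hDs.le

lemma isPrecompactL1_of_eventually_nonlocalPerimeter_le (hΩ : IsOpen Ω) (hvol : volume Ω ≠ ∞)
    (hρ₀ : MemBV Ω ρ₀) (hρ₁ : MemBV Ω ρ₁) (hρ₀0 : ∀ᵐ x ∂volume.restrict Ω, 0 ≤ ρ₀ x)
    (hρ₁0 : ∀ᵐ x ∂volume.restrict Ω, 0 ≤ ρ₁ x) (hc : 0 < c)
    (hρ : ∀ᵐ x ∂volume.restrict Ω, c ≤ ρ₀ x + ρ₁ x) (hε_pos : ∀ k, 0 < ε k)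
    (hε : Tendsto ε atTop (𝓝 0)) (hA : ∀ k, MeasurableSet (A k) ∧ A k ⊆ Ω)
    (hPer : ∀ᶠ k in atTop, nonlocalPerimeter Ω ρ₀ ρ₁ (ε k) (A k) ≤ M) :
    IsPrecompactL1 Ω A := by
  intro ψ hψ
  obtain ⟨φ, hφ, A₀, hA₀, hA₀Ω, hlim⟩ := exists_subseq_tendsto_measure_symmDiff hΩ.measurableSet
    hvol (fun k => (hA (ψ k)).1) (fun k => (hA (ψ k)).2) fun δ hδ => by
      obtain ⟨K, hKΩ, hK, hΩK⟩ := hΩ.measurableSet.exists_isCompact_sdiff_lt hvol hδ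
      obtain ⟨r, hr, hflip⟩ := exists_eventually_volume_inter_flipSet_le hΩ hρ₀ hρ₁ hρ₀0 hρ₁0 hc
        hρ hε_pos hε hA hPer hK hKΩ hδ
      exact ⟨K, hKΩ, hΩK.le, r, hr, hψ.tendsto_atTop.eventually hflip⟩
  refine ⟨φ, hφ, A₀, hA₀, hA₀Ω, ?_⟩
  simp only [TendstoL1, eLpNorm_chi_sub_chi (hA _).1 hA₀]
  exact tendsto_of_tendsto_of_tendsto_of_le_of_le tendsto_const_nhds hlim (fun _ => zero_le)
    fun k => Measure.restrict_le_self _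

end Precompactness

end AdvTraining

theorem mainTheorem9_general {d : ℕ} {Ω : Set (E d)} (hΩ : IsOpen Ω) (hvol : volume Ω ≠ ∞)
    {ρ₀ ρ₁ : E d → ℝ} (hρ₀_nonneg : ∀ᵐ x ∂volume.restrict Ω, 0 ≤ ρ₀ x)
    (hρ₁_nonneg : ∀ᵐ x ∂volume.restrict Ω, 0 ≤ ρ₁ x)
    (hρ₀_BV : MemBV Ω ρ₀) (hρ₁_BV : MemBV Ω ρ₁)
    (hρ₀_bdd : MemLp ρ₀ ∞ (volume.restrict Ω)) (hρ₁_bdd : MemLp ρ₁ ∞ (volume.restrict Ω))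
    (hρ : ∃ c : ℝ, 0 < c ∧ ∀ᵐ x ∂volume.restrict Ω, c ≤ ρ₀ x + ρ₁ x)
    {ε : ℕ → ℝ} (hε_pos : ∀ k, 0 < ε k) (hε : Tendsto ε atTop (𝓝 0))
    {A₀ : Set (E d)} (hA₀ : IsBayesClassifier Ω ρ₀ ρ₁ A₀)
    {B : ℕ → Set (E d)} (hB : ∀ k, MeasurableSet (B k) ∧ B k ⊆ Ω)
    (hPer : limsup (fun k => nonlocalPerimeter Ω ρ₀ ρ₁ (ε k) (B k)) atTop < ∞)
    (hdist : (fun k => volume.real (symmDiff A₀ (B k))) =O[atTop] ε)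
    {A : ℕ → Set (E d)} (hA : ∀ k, IsAdversarialSolution Ω ρ₀ ρ₁ (ε k) (A k)) :
    IsPrecompactL1 Ω A := by
  obtain ⟨c, hc, hρ⟩ := hρ
  obtain ⟨M, hM⟩ := exists_eventually_nonlocalPerimeter_le hΩ hvol hρ₀_nonneg hρ₁_nonneg
    hρ₀_bdd hρ₁_bdd hε_pos hA₀ hB hPer hdist hA
  exact isPrecompactL1_of_eventually_nonlocalPerimeter_le hΩ hvol hρ₀_BV hρ₁_BV hρ₀_nonneg
    hρ₁_nonneg hc hρ hε_pos hε (fun k => (hA k).1) hM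

theorem mainTheorem9 {d : ℕ} (hd : 1 ≤ d) (Ω : Set (E d)) (hΩ : IsBoundedLipschitzDomain Ω)
    (ρ₀ ρ₁ : E d → ℝ)
    (hρ₀_nonneg : ∀ᵐ x ∂(volume.restrict Ω), 0 ≤ ρ₀ x)
    (hρ₁_nonneg : ∀ᵐ x ∂(volume.restrict Ω), 0 ≤ ρ₁ x)
    (hρ₀_BV : MemBV Ω ρ₀) (hρ₁_BV : MemBV Ω ρ₁)
    (hρ₀_bdd : MemLp ρ₀ ∞ (volume.restrict Ω)) (hρ₁_bdd : MemLp ρ₁ ∞ (volume.restrict Ω))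
    (hρ : ∃ c : ℝ, 0 < c ∧ ∀ᵐ x ∂(volume.restrict Ω), c ≤ ρ₀ x + ρ₁ x)
    (ε : ℕ → ℝ) (hε_pos : ∀ k, 0 < ε k) (hε : Tendsto ε atTop (𝓝 0))
    (hSC : WeakSourceCondition Ω ρ₀ ρ₁ ε)
    (A : ℕ → Set (E d)) (hA : ∀ k, IsAdversarialSolution Ω ρ₀ ρ₁ (ε k) (A k)) :
    IsPrecompactL1 Ω A := by
  obtain ⟨A₀, hA₀, hPer, B, hB, hdist⟩ := hSC
  exact mainTheorem9_general hΩ.isOpen hΩ.isBounded.measure_lt_top.ne hρ₀_nonneg hρ₁_nonneg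
    hρ₀_BV hρ₁_BV hρ₀_bdd hρ₁_bdd hρ hε_pos hε hA₀ hB.measurable (hB.limsup_le.trans_lt hPer)
    hdist.isBigO hA
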